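/- **Maximum principle.** Let $N\ge 2$, let $D\subset\mathbb R^N$ be a bounded domain (nonempty, open, connected) with smooth boundary $\Gamma=\partial D$ and outward unit normal $\mathbf n$, and let $\Gamma$ carry its surface measure. Let $\varepsilon\ge 0$ and $\delta>0$. Let $\tau:H^1(D)\to L^2(\Gamma)$ be the trace operator, with range $H^{1/2}(\Gamma)$, and set $$\mathcal V_\varepsilon=\{(u,v)\in H^1(D)\times V^\varepsilon_\Gamma:\ v=\tau u\},\qquad V^\varepsilon_\Gamma=H^1(\Gamma)\ \text{if } \varepsilon>0,\quad V^0_\Gamma=H^{1/2}(\Gamma).$$ Let $\mathcal C_\varepsilon(u,v)=(-\Delta u,\ \partial_{\mathbf n}u-\varepsilon\Delta_\Gamma v)$ be the linear operator on $L^2(D)\times L^2(\Gamma)$ given by the bilinear form on $\mathcal V_\varepsilon$: for $(u,v)\in\mathcal V_\varepsilon$ and $(a,b)\in L^2(D)\times L^2(\Gamma)$, $\mathcal C_\varepsilon(u,v)=(a,b)$ means $$\int_D\nabla u\cdot\nabla\varphi+\varepsilon\int_\Gamma\nabla_\Gamma v\cdot\nabla_\Gamma\psi=\int_D a\,\varphi+\int_\Gamma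 b\,\psi\qquad\forall(\varphi,\psi)\in\mathcal V_\varepsilon .$$ Then the resolvent $(I+\delta\mathcal C_\varepsilon)^{-1}$, which assigns to $(f,g)\in L^2(D)\times L^2(\Gamma)$ the solution $(u,v)$ of $(u,v)+\delta\,\mathcal C_\varepsilon(u,v)=(f,g)$, extends to exactly one bounded linear operator on $L^1(D)\times L^1(\Gamma)$, again denoted by $(I+\delta\mathcal C_\varepsilon)^{-1}$. Moreover, if $c_1,c_2>0$ and $(f,g)\in L^1(D)\times L^1(\Gamma)$ satisfy $f\le c_1$ a.e. on $D$ and $g\le c_2$ a.e. on $\Gamma$, then $(u,v):=(I+\delta\mathcal C_\varepsilon)^{-1}(f,g)$ satisfies $$u\le\max\{c_1,c_2\}\ \text{ a.e. on } D,\qquad v\le\max\{c_1,c_2\}\ \text{ a.e. on } \Gamma .$$ -/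

import Mathlib

open MeasureTheory Filter Topology Set
open scoped ContDiff ENNReal MeasureTheory

noncomputable section

namespace WentzellResolvent

variable {N : ℕ}

/-- Local description of the set `D` near a boundary point: on the open set `U` the function `r` is
smooth with nowhere vanishing gradient, and `D` is the set where `r` is negative. -/
structure IsLocalDefiningFunction (D U : Set (EuclideanSpace ℝ (Fin N)))
    (r : EuclideanSpace ℝ (Fin N) → ℝ) : Prop where
  isOpen : IsOpen U
  contDiffOn : ContDiffOn ℝ ∞ r U
  gradient_ne_zero : ∀ y ∈ U, gradient r y ≠ 0
  mem_iff : ∀ y ∈ U, (y ∈ D ↔ r y < 0)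

/-- A bounded domain (nonempty, open, connected) of `ℝ^N` with smooth boundary, lying locally on
one side of its boundary. -/
structure IsSmoothBoundedDomain (D : Set (EuclideanSpace ℝ (Fin N))) : Prop where
  isOpen : IsOpen D
  isConnected : IsConnected D
  isBounded : Bornology.IsBounded D
  smooth_boundary : ∀ x ∈ frontier D, ∃ U r, x ∈ U ∧ IsLocalDefiningFunction D U r

/-- `ν` is the outward unit normal to `D` at the boundary point `x`. -/
def IsOutwardUnitNormal (D : Set (EuclideanSpace ℝ (Fin N)))
    (x ν : EuclideanSpace ℝ (Fin N)) : Prop :=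
  x ∈ frontier D ∧ ∃ U r, x ∈ U ∧ IsLocalDefiningFunction D U r ∧
    ν = ‖gradient r x‖⁻¹ • gradient r x

open Classical in
/-- The outward unit normal field `n` on `Γ = ∂D` (it exists and is unique at every boundary point
of a smooth domain; the value `0` elsewhere is not used). -/
def outwardNormal (D : Set (EuclideanSpace ℝ (Fin N))) (x : EuclideanSpace ℝ (Fin N)) :
    EuclideanSpace ℝ (Fin N) :=
  if h : ∃ ν, IsOutwardUnitNormal D x ν then h.choose else 0

/-- Lebesgue measure on `D`. -/
def bulkMeasure (D : Set (EuclideanSpace ℝ (Fin N))) : Measure (EuclideanSpace ℝ (Fin N)) :=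
  volume.restrict D

/-- Surface measure on `Γ = ∂D`: the `(N-1)`-dimensional Hausdorff measure, normalised so that it is
Lebesgue measure on hyperplanes, restricted to `Γ`. -/
def surfaceMeasure (D : Set (EuclideanSpace ℝ (Fin N))) : Measure (EuclideanSpace ℝ (Fin N)) :=
  (μHE[N - 1] : Measure (EuclideanSpace ℝ (Fin N))).restrict (frontier D)

/-- The surface gradient `∇_Γ φ = ∇φ - (∇φ · n) n` of (the restriction to `Γ` of) a function `φ`
that is smooth on `ℝ^N`. -/
def tangentialGradient (D : Set (EuclideanSpace ℝ (Fin N))) (φ : EuclideanSpace ℝ (Fin N) → ℝ)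
    (x : EuclideanSpace ℝ (Fin N)) : EuclideanSpace ℝ (Fin N) :=
  gradient φ x - (inner ℝ (gradient φ x) (outwardNormal D x)) • outwardNormal D x

/-- `u ∈ H¹(D)` with weak gradient `p = ∇u`. -/
structure IsWeakGradient (D : Set (EuclideanSpace ℝ (Fin N))) (u : EuclideanSpace ℝ (Fin N) → ℝ)
    (p : EuclideanSpace ℝ (Fin N) → EuclideanSpace ℝ (Fin N)) : Prop where
  memLp : MemLp u 2 (bulkMeasure D)
  memLp_gradient : MemLp p 2 (bulkMeasure D)
  integral_eq : ∀ θ : EuclideanSpace ℝ (Fin N) → ℝ, ContDiff ℝ ∞ θ → HasCompactSupport θ →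
    tsupport θ ⊆ D →
    ∫ x, u x • gradient θ x ∂(bulkMeasure D) = -∫ x, θ x • p x ∂(bulkMeasure D)

/-- `u ∈ H¹(D)`. -/
def MemH1 (D : Set (EuclideanSpace ℝ (Fin N))) (u : EuclideanSpace ℝ (Fin N) → ℝ) : Prop :=
  ∃ p, IsWeakGradient D u p

/-- `v = τ u`, where `τ : H¹(D) → L²(Γ)` is the trace operator, that is, the continuous extension of
the restriction `φ ↦ φ|_Γ` from `C^∞(D̄)` (restrictions to `D̄` of smooth functions on `ℝ^N`),
which is dense in `H¹(D)`. -/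
def IsTrace (D : Set (EuclideanSpace ℝ (Fin N))) (u v : EuclideanSpace ℝ (Fin N) → ℝ) : Prop :=
  MemLp v 2 (surfaceMeasure D) ∧
  ∃ p, IsWeakGradient D u p ∧
    ∃ φ : ℕ → EuclideanSpace ℝ (Fin N) → ℝ, (∀ n, ContDiff ℝ ∞ (φ n)) ∧
      Tendsto (fun n => eLpNorm (φ n - u) 2 (bulkMeasure D)) atTop (𝓝 0) ∧
      Tendsto (fun n => eLpNorm (gradient (φ n) - p) 2 (bulkMeasure D)) atTop (𝓝 0) ∧
      Tendsto (fun n => eLpNorm (φ n - v) 2 (surfaceMeasure D)) atTop (𝓝 0)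

/-- `v ∈ H¹(Γ)` with surface gradient `w = ∇_Γ v`; here `H¹(Γ)` is the completion of `C^∞(Γ)` in the
norm `(‖v‖²_{L²(Γ)} + ‖∇_Γ v‖²_{L²(Γ)})^{1/2}`. Smooth functions on the compact hypersurface `Γ` are
the restrictions of smooth functions on `ℝ^N`. -/
def IsSurfaceGradient (D : Set (EuclideanSpace ℝ (Fin N))) (v : EuclideanSpace ℝ (Fin N) → ℝ)
    (w : EuclideanSpace ℝ (Fin N) → EuclideanSpace ℝ (Fin N)) : Prop :=
  MemLp v 2 (surfaceMeasure D) ∧ MemLp w 2 (surfaceMeasure D) ∧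
  ∃ φ : ℕ → EuclideanSpace ℝ (Fin N) → ℝ, (∀ n, ContDiff ℝ ∞ (φ n)) ∧
    Tendsto (fun n => eLpNorm (φ n - v) 2 (surfaceMeasure D)) atTop (𝓝 0) ∧
    Tendsto (fun n => eLpNorm (tangentialGradient D (φ n) - w) 2 (surfaceMeasure D)) atTop (𝓝 0)

/-- `v ∈ H¹(Γ)`. -/
def MemH1Boundary (D : Set (EuclideanSpace ℝ (Fin N))) (v : EuclideanSpace ℝ (Fin N) → ℝ) : Prop :=
  ∃ w, IsSurfaceGradient D v w

/-- `v ∈ H^{1/2}(Γ)`, the range of the trace operator on `H¹(D)`. -/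
def MemHHalfBoundary (D : Set (EuclideanSpace ℝ (Fin N))) (v : EuclideanSpace ℝ (Fin N) → ℝ) :
    Prop :=
  ∃ u, MemH1 D u ∧ IsTrace D u v

/-- `v ∈ V_Γ^ε`, where `V_Γ^ε = H¹(Γ)` if `ε > 0` and `V_Γ^0 = H^{1/2}(Γ)`. -/
def MemVBoundary (D : Set (EuclideanSpace ℝ (Fin N))) (ε : ℝ)
    (v : EuclideanSpace ℝ (Fin N) → ℝ) : Prop :=
  (0 < ε → MemH1Boundary D v) ∧ (ε = 0 → MemHHalfBoundary D v)

/-- `(u, v) ∈ 𝒱_ε = {(u, v) ∈ H¹(D) × V_Γ^ε : v = τ u}`. -/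
def MemV (D : Set (EuclideanSpace ℝ (Fin N))) (ε : ℝ)
    (u v : EuclideanSpace ℝ (Fin N) → ℝ) : Prop :=
  MemH1 D u ∧ MemVBoundary D ε v ∧ IsTrace D u v

/-- `(u, v) ∈ 𝒱_ε`, with `p = ∇u` and, if `ε > 0`, `w = ∇_Γ v`. If `ε = 0` there is no condition on
`w`, which then enters the bilinear form below only with the factor `ε = 0`. -/
def MemVWithGradients (D : Set (EuclideanSpace ℝ (Fin N))) (ε : ℝ)
    (u v : EuclideanSpace ℝ (Fin N) → ℝ)
    (p w : EuclideanSpace ℝ (Fin N) → EuclideanSpace ℝ (Fin N)) : Prop :=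
  MemV D ε u v ∧ IsWeakGradient D u p ∧ (0 < ε → IsSurfaceGradient D v w)

/-- The graph of the operator `𝒞_ε` on `L²(D) × L²(Γ)`: `(u, v) ∈ 𝒱_ε` and `𝒞_ε (u, v) = (a, b)`,
where `𝒞_ε` is given by the bilinear form
`⟨𝒞_ε (u, v), (φ, ψ)⟩ = ∫_D ∇u·∇φ + ε ∫_Γ ∇_Γ v·∇_Γ ψ` on `𝒱_ε`. Thus `a = -Δu` in the sense of
distributions on `D` (take `ψ = 0`), and `b = ∂_n u - ε Δ_Γ v` weakly on `Γ`. -/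
def IsCeps (D : Set (EuclideanSpace ℝ (Fin N))) (ε : ℝ)
    (u v a b : EuclideanSpace ℝ (Fin N) → ℝ) : Prop :=
  MemLp a 2 (bulkMeasure D) ∧ MemLp b 2 (surfaceMeasure D) ∧
  ∃ p w, MemVWithGradients D ε u v p w ∧
    ∀ φ ψ q z, MemVWithGradients D ε φ ψ q z →
      ∫ x, inner ℝ (p x) (q x) ∂(bulkMeasure D)
        + ε * ∫ x, inner ℝ (w x) (z x) ∂(surfaceMeasure D)
      = ∫ x, a x * φ x ∂(bulkMeasure D) + ∫ x, b x * ψ x ∂(surfaceMeasure D)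

/-- `(u, v) = (I + δ 𝒞_ε)⁻¹ (f, g)` in `L²(D) × L²(Γ)`, i.e. `(u, v) + δ 𝒞_ε (u, v) = (f, g)`. -/
def IsResolventL2 (D : Set (EuclideanSpace ℝ (Fin N))) (ε δ : ℝ)
    (f g u v : EuclideanSpace ℝ (Fin N) → ℝ) : Prop :=
  ∃ a b, IsCeps D ε u v a b ∧
    (∀ᵐ x ∂(bulkMeasure D), u x + δ * a x = f x) ∧
    (∀ᵐ x ∂(surfaceMeasure D), v x + δ * b x = g x)

/-- The space `L¹(D) × L¹(Γ)`. -/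
abbrev L1Space (D : Set (EuclideanSpace ℝ (Fin N))) : Type :=
  Lp ℝ 1 (bulkMeasure D) × Lp ℝ 1 (surfaceMeasure D)

/-- `R` is a bounded linear operator on `L¹(D) × L¹(Γ)` that extends the resolvent
`(I + δ 𝒞_ε)⁻¹` of `L²(D) × L²(Γ)`. -/
def IsResolventL1 (D : Set (EuclideanSpace ℝ (Fin N))) (ε δ : ℝ)
    (R : L1Space D →L[ℝ] L1Space D) : Prop :=
  ∀ F : L1Space D, MemLp F.1 2 (bulkMeasure D) → MemLp F.2 2 (surfaceMeasure D) →
    IsResolventL2 D ε δ F.1 F.2 (R F).1 (R F).2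

end WentzellResolvent

end

/-!
The gradients entering the energy obey the chain rule, so for smooth `η` with bounded `η'` and
`η 0 = 0` the pair `(η ∘ u, η ∘ v)` is again admissible, with gradients `η'(u) ∇u` and
`η'(v) ∇_Γ v`. Tested against a solution of the resolvent equation with `η` nondecreasing, the
Dirichlet form is nonnegative and drops out. Letting `η` increase to the indicator of `(M, ∞)`,
`M ≥ 0`, gives for `L²` data
`∫ (u - M)⁺ + ∫ (v - M)⁺ ≤ ∫ (f - M)⁺ + ∫ (g - M)⁺`.
With `M = 0`, applied to the data and their negatives, this is contractivity in `L¹`, so the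
resolvent extends uniquely from the dense subspace `L¹ ∩ L²`. The inequality passes to the limit,
and its right-hand side vanishes for `M = max c₁ c₂`. The resolvent on `L²` itself is the orthogonal
projection onto `𝒱_ε` in an energy space, compressed to `L²(D) × L²(Γ)`.
-/

noncomputable section

namespace WentzellResolvent

section Lebesgue

variable {α E F : Type*} [MeasurableSpace α] {μ : Measure α} [NormedAddCommGroup E]
  [NormedAddCommGroup F] {p : ℝ≥0∞}

theorem tendsto_eLpNorm_zero_of_le_mul {f : ℕ → α → E} {g : ℕ → α → F} (C : ℝ)
    (hle : ∀ n x, ‖f n x‖ ≤ C * ‖g n x‖)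
    (hg : Tendsto (fun n ↦ eLpNorm (g n) p μ) atTop (𝓝 0)) :
    Tendsto (fun n ↦ eLpNorm (f n) p μ) atTop (𝓝 0) := by
  have hCg := ENNReal.Tendsto.const_mul (a := ENNReal.ofReal C) hg (Or.inr ENNReal.ofReal_ne_top)
  rw [mul_zero] at hCg
  exact tendsto_of_tendsto_of_tendsto_of_le_of_le tendsto_const_nhds hCg (fun n ↦ zero_le)
    fun n ↦ eLpNorm_le_mul_eLpNorm_of_ae_le_mul (Eventually.of_forall (hle n)) p

theorem tendsto_eLpNorm_zero_of_dominated (hp₀ : p ≠ 0) (hp : p ≠ ⊤) {f : ℕ → α → E} {g : α → F}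
    (hf : ∀ n, AEStronglyMeasurable (f n) μ) (hg : MemLp g p μ) (hle : ∀ n x, ‖f n x‖ ≤ ‖g x‖)
    (hlim : ∀ᵐ x ∂μ, Tendsto (fun n ↦ f n x) atTop (𝓝 0)) :
    Tendsto (fun n ↦ eLpNorm (f n) p μ) atTop (𝓝 0) := by
  have hp' : 0 < p.toReal := ENNReal.toReal_pos hp₀ hp
  have hrpow (r : ℝ) (hr : 0 < r) : Tendsto (fun t : ℝ≥0∞ ↦ t ^ r) (𝓝 0) (𝓝 0) := by
    simpa only [ENNReal.zero_rpow_of_pos hr] using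
      (ENNReal.continuous_rpow_const (y := r)).tendsto 0
  have hlint : Tendsto (fun n ↦ ∫⁻ x, ‖f n x‖ₑ ^ p.toReal ∂μ) atTop (𝓝 0) := by
    rw [← lintegral_zero (μ := μ)]
    refine tendsto_lintegral_of_dominated_convergence' (fun x ↦ ‖g x‖ₑ ^ p.toReal)
      (fun n ↦ (hf n).enorm.pow_const _) (fun n ↦ Eventually.of_forall fun x ↦ ?_)
      (lintegral_rpow_enorm_lt_top_of_eLpNorm_lt_top hp₀ hp hg.2).ne ?_
    · exact ENNReal.rpow_le_rpow (enorm_le_iff_norm_le.2 (hle n x)) hp'.le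
    · filter_upwards [hlim] with x hx
      exact (hrpow _ hp').comp (by simpa using hx.enorm)
  exact ((hrpow (1 / p.toReal) (by positivity)).comp hlint).congr fun n ↦
    (eLpNorm_eq_lintegral_rpow_enorm_toReal hp₀ hp).symm

theorem tendsto_eLpNorm_comp_sub_comp {C : NNReal} {η : E → F} (hη : LipschitzWith C η)
    {φ : ℕ → α → E} {u : α → E}
    (hφ : Tendsto (fun n ↦ eLpNorm (φ n - u) p μ) atTop (𝓝 0)) :
    Tendsto (fun n ↦ eLpNorm (η ∘ φ n - η ∘ u) p μ) atTop (𝓝 0) :=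
  tendsto_eLpNorm_zero_of_le_mul C (fun n x ↦ hη.norm_sub_le (φ n x) (u x)) hφ

variable [NormedSpace ℝ F]

theorem tendsto_eLpNorm_comp_smul_sub_comp_smul (hp₁ : 1 ≤ p) (hp : p ≠ ⊤) {h : E → ℝ} {C : ℝ}
    (hh : Continuous h) (hC : ∀ s, ‖h s‖ ≤ C) {φ : ℕ → α → E} {u : α → E} {Q : ℕ → α → F}
    {q : α → F} (hφm : ∀ n, AEStronglyMeasurable (φ n) μ) (hum : AEStronglyMeasurable u μ)
    (hQm : ∀ n, AEStronglyMeasurable (Q n) μ) (hq : MemLp q p μ)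
    (hφ : Tendsto (fun n ↦ eLpNorm (φ n - u) p μ) atTop (𝓝 0))
    (hQ : Tendsto (fun n ↦ eLpNorm (Q n - q) p μ) atTop (𝓝 0)) :
    Tendsto (fun n ↦ eLpNorm ((h ∘ φ n) • Q n - (h ∘ u) • q) p μ) atTop (𝓝 0) := by
  have hp₀ : p ≠ 0 := (zero_lt_one.trans_le hp₁).ne'
  have hhm n : AEStronglyMeasurable (h ∘ φ n) μ := hh.comp_aestronglyMeasurable (hφm n)
  have hhu : AEStronglyMeasurable (h ∘ u) μ := hh.comp_aestronglyMeasurable hum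
  have hvary : Tendsto (fun n ↦ eLpNorm ((h ∘ φ n) • (Q n - q)) p μ) atTop (𝓝 0) := by
    refine tendsto_eLpNorm_zero_of_le_mul C (fun n x ↦ ?_) hQ
    exact (norm_smul _ _).trans_le (mul_le_mul_of_nonneg_right (hC _) (norm_nonneg _))
  have hfixed : Tendsto (fun n ↦ eLpNorm ((h ∘ φ n - h ∘ u) • q) p μ) atTop (𝓝 0) := by
    refine tendsto_of_subseq_tendsto fun ns hns ↦ ?_
    obtain ⟨ms, -, hms⟩ := (tendstoInMeasure_of_tendsto_eLpNorm hp₀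
      (fun n ↦ hφm (ns n)) hum (hφ.comp hns)).exists_seq_tendsto_ae
    refine ⟨ms, tendsto_eLpNorm_zero_of_dominated hp₀ hp (g := (C + C) • q)
      (fun n ↦ ((hhm _).sub hhu).smul hq.1) (hq.const_smul (C + C)) (fun n x ↦ ?_) ?_⟩
    · simp only [Pi.smul_apply', Pi.smul_apply, norm_smul, Pi.sub_apply, Function.comp_apply]
      gcongr
      exact (norm_sub_le_of_le (hC _) (hC _)).trans (le_abs_self _)
    · filter_upwards [hms] with x hx
      simpa using (((hh.tendsto _).comp hx).sub_const (h (u x))).smul_const (q x)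
  refine tendsto_of_tendsto_of_tendsto_of_le_of_le tendsto_const_nhds
    (by simpa using hvary.add hfixed) (fun n ↦ zero_le) fun n ↦ ?_
  have hsplit : (h ∘ φ n) • Q n - (h ∘ u) • q
      = (h ∘ φ n) • (Q n - q) + (h ∘ φ n - h ∘ u) • q := by
    rw [smul_sub, sub_smul, sub_add_sub_cancel]
  rw [hsplit]
  exact eLpNorm_add_le ((hhm n).smul ((hQm n).sub hq.1)) (((hhm n).sub hhu).smul hq.1) hp₁

end Lebesgue

section SmoothLimits

theorem memLp_of_eLpNorm_sub_lt_top {α F : Type*} [MeasurableSpace α] {μ : Measure α}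
    [NormedAddCommGroup F] {p : ℝ≥0∞} {f g : α → F} (hf : MemLp f p μ)
    (hg : AEStronglyMeasurable g μ) (h : eLpNorm (g - f) p μ < ⊤) : MemLp g p μ := by
  simpa only [sub_add_cancel] using MemLp.add ⟨hg.sub hf.1, h⟩ hf

theorem edist_toLp_right {α F : Type*} [MeasurableSpace α] {μ : Measure α}
    [NormedAddCommGroup F] {p : ℝ≥0∞} (f : Lp F p μ) {g : α → F} (hg : MemLp g p μ) :
    edist f (hg.toLp g) = eLpNorm (g - ⇑f) p μ := by
  rw [Lp.edist_def, eLpNorm_sub_comm]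
  exact eLpNorm_congr_ae (hg.coeFn_toLp.sub .rfl)

variable {E F : Type*} [NormedAddCommGroup E] [NormedSpace ℝ E] [MeasurableSpace E]
  [NormedAddCommGroup F] {μ ν : Measure E} {G : (E → ℝ) → E → F}

/-- The triple `(u, q, v)` is a limit in `L²(μ) × L²(μ) × L²(ν)` of triples `(φ, G φ, φ)` with `φ`
smooth on the whole space. With `ν` the surface measure, `v` is the trace of `u`. -/
def IsSmoothLimit (μ ν : Measure E) (G : (E → ℝ) → E → F) (u : E → ℝ) (q : E → F) (v : E → ℝ) :
    Prop :=
  ∃ φ : ℕ → E → ℝ, (∀ n, ContDiff ℝ ∞ (φ n)) ∧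
    Tendsto (fun n ↦ eLpNorm (φ n - u) 2 μ) atTop (𝓝 0) ∧
    Tendsto (fun n ↦ eLpNorm (G (φ n) - q) 2 μ) atTop (𝓝 0) ∧
    Tendsto (fun n ↦ eLpNorm (φ n - v) 2 ν) atTop (𝓝 0)

theorem IsSmoothLimit.congr_ae {u u' v v' : E → ℝ} {q q' : E → F}
    (h : IsSmoothLimit μ ν G u q v) (hu : u =ᵐ[μ] u') (hq : q =ᵐ[μ] q') (hv : v =ᵐ[ν] v') :
    IsSmoothLimit μ ν G u' q' v' := by
  obtain ⟨φ, hφ, hφu, hφq, hφv⟩ := h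
  exact ⟨φ, hφ, hφu.congr fun n ↦ eLpNorm_congr_ae (EventuallyEq.rfl.sub hu),
    hφq.congr fun n ↦ eLpNorm_congr_ae (EventuallyEq.rfl.sub hq),
    hφv.congr fun n ↦ eLpNorm_congr_ae (EventuallyEq.rfl.sub hv)⟩

variable [NormedSpace ℝ F]

/-- A first-order differential operator on smooth functions that satisfies the chain rule, such as
the gradient or the surface gradient, with values measurable with respect to `μ`. -/
structure IsDerivation (μ : Measure E) (G : (E → ℝ) → E → F) : Prop where
  aestronglyMeasurable {φ : E → ℝ} : ContDiff ℝ ∞ φ → AEStronglyMeasurable (G φ) μ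
  map_add {φ ψ : E → ℝ} : ContDiff ℝ ∞ φ → ContDiff ℝ ∞ ψ → G (φ + ψ) = G φ + G ψ
  map_smul (c : ℝ) {φ : E → ℝ} : ContDiff ℝ ∞ φ → G (c • φ) = c • G φ
  map_comp {η : ℝ → ℝ} {φ : E → ℝ} : ContDiff ℝ ∞ η → ContDiff ℝ ∞ φ →
    G (η ∘ φ) = (deriv η ∘ φ) • G φ

theorem IsDerivation.map_zero (hG : IsDerivation μ G) : G 0 = 0 := by
  simpa only [zero_smul] using hG.map_smul 0 (φ := 0) contDiff_const

variable [OpensMeasurableSpace E]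

theorem IsSmoothLimit.comp (hG : IsDerivation μ G) {u v : E → ℝ} {q : E → F}
    (h : IsSmoothLimit μ ν G u q v) (hu : AEStronglyMeasurable u μ) (hq : MemLp q 2 μ)
    {η : ℝ → ℝ} {C : NNReal} (hη : ContDiff ℝ ∞ η) (hηC : LipschitzWith C η) :
    IsSmoothLimit μ ν G (η ∘ u) ((deriv η ∘ u) • q) (η ∘ v) := by
  obtain ⟨φ, hφ, hφu, hφq, hφv⟩ := h
  refine ⟨fun n ↦ η ∘ φ n, fun n ↦ hη.comp (hφ n), tendsto_eLpNorm_comp_sub_comp hηC hφu, ?_,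
    tendsto_eLpNorm_comp_sub_comp hηC hφv⟩
  simp only [fun n ↦ hG.map_comp hη (hφ n)]
  exact tendsto_eLpNorm_comp_smul_sub_comp_smul one_le_two ENNReal.ofNat_ne_top
    (hη.continuous_deriv (by simp)) (fun s ↦ norm_deriv_le_of_lipschitz hηC)
    (fun n ↦ (hφ n).continuous.aestronglyMeasurable) hu
    (fun n ↦ hG.aestronglyMeasurable (hφ n)) hq hφu hφq

/-- The triples `(φ, G φ, φ)` with `φ` smooth whose components are all square integrable. -/
def smoothGraph (hG : IsDerivation μ G) (ν : Measure E) :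
    Submodule ℝ (Lp ℝ 2 μ × Lp F 2 μ × Lp ℝ 2 ν) where
  carrier := {X | ∃ φ : E → ℝ, ContDiff ℝ ∞ φ ∧ X.1 =ᵐ[μ] φ ∧ X.2.1 =ᵐ[μ] G φ ∧ X.2.2 =ᵐ[ν] φ}
  add_mem' := by
    rintro X Y ⟨φ, hφ, hX₁, hX₂, hX₃⟩ ⟨ψ, hψ, hY₁, hY₂, hY₃⟩
    exact ⟨φ + ψ, hφ.add hψ, (Lp.coeFn_add _ _).trans (hX₁.add hY₁),
      hG.map_add hφ hψ ▸ (Lp.coeFn_add _ _).trans (hX₂.add hY₂),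
      (Lp.coeFn_add _ _).trans (hX₃.add hY₃)⟩
  zero_mem' := ⟨0, contDiff_const, Lp.coeFn_zero _ _ _, hG.map_zero ▸ Lp.coeFn_zero _ _ _,
    Lp.coeFn_zero _ _ _⟩
  smul_mem' := by
    rintro c X ⟨φ, hφ, hX₁, hX₂, hX₃⟩
    exact ⟨c • φ, contDiff_const.smul hφ, (Lp.coeFn_smul _ _).trans (hX₁.const_smul c),
      hG.map_smul c hφ ▸ (Lp.coeFn_smul _ _).trans (hX₂.const_smul c),
      (Lp.coeFn_smul _ _).trans (hX₃.const_smul c)⟩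

theorem mem_topologicalClosure_smoothGraph_iff (hG : IsDerivation μ G)
    {X : Lp ℝ 2 μ × Lp F 2 μ × Lp ℝ 2 ν} :
    X ∈ (smoothGraph hG ν).topologicalClosure ↔ IsSmoothLimit μ ν G X.1 X.2.1 X.2.2 := by
  rw [← SetLike.mem_coe, Submodule.topologicalClosure_coe]
  constructor
  · rw [mem_closure_iff_seq_limit]
    rintro ⟨Y, hY, hYX⟩
    choose φ hφ hY₁ hY₂ hY₃ using hY
    refine ⟨φ, hφ, ?_, ?_, ?_⟩
    · exact ((Lp.tendsto_Lp_iff_tendsto_eLpNorm' _ _).1 hYX.fst_nhds).congr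
        fun n ↦ eLpNorm_congr_ae ((hY₁ n).sub .rfl)
    · exact ((Lp.tendsto_Lp_iff_tendsto_eLpNorm' _ _).1 hYX.snd_nhds.fst_nhds).congr
        fun n ↦ eLpNorm_congr_ae ((hY₂ n).sub .rfl)
    · exact ((Lp.tendsto_Lp_iff_tendsto_eLpNorm' _ _).1 hYX.snd_nhds.snd_nhds).congr
        fun n ↦ eLpNorm_congr_ae ((hY₃ n).sub .rfl)
  · rintro ⟨φ, hφ, hφ₁, hφ₂, hφ₃⟩
    refine EMetric.mem_closure_iff.2 fun ρ hρ ↦ ?_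
    obtain ⟨n, h₁, h₂, h₃⟩ := ((hφ₁.eventually_lt_const hρ).and
      ((hφ₂.eventually_lt_const hρ).and (hφ₃.eventually_lt_const hρ))).exists
    have hm₁ := memLp_of_eLpNorm_sub_lt_top (Lp.memLp X.1) (hφ n).continuous.aestronglyMeasurable
      (h₁.trans_le le_top)
    have hm₂ := memLp_of_eLpNorm_sub_lt_top (Lp.memLp X.2.1) (hG.aestronglyMeasurable (hφ n))
      (h₂.trans_le le_top)
    have hm₃ := memLp_of_eLpNorm_sub_lt_top (Lp.memLp X.2.2)
      (hφ n).continuous.aestronglyMeasurable (h₃.trans_le le_top)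
    refine ⟨(hm₁.toLp, hm₂.toLp, hm₃.toLp), ⟨φ n, hφ n, hm₁.coeFn_toLp, hm₂.coeFn_toLp,
      hm₃.coeFn_toLp⟩, ?_⟩
    simpa only [Prod.edist_eq, edist_toLp_right, max_lt_iff] using ⟨h₁, h₂, h₃⟩

end SmoothLimits

section Gradient

variable {E : Type*} [NormedAddCommGroup E] [InnerProductSpace ℝ E] [CompleteSpace E]
  {φ ψ : E → ℝ}

theorem continuousOn_gradient {U : Set E} (hφ : ContDiffOn ℝ ∞ φ U) (hU : IsOpen U) :
    ContinuousOn (gradient φ) U :=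
  (InnerProductSpace.toDual ℝ E).symm.continuous.comp_continuousOn
    (hφ.continuousOn_fderiv_of_isOpen hU (by simp))

theorem continuous_gradient (hφ : ContDiff ℝ ∞ φ) : Continuous (gradient φ) :=
  continuousOn_univ.1 (continuousOn_gradient hφ.contDiffOn isOpen_univ)

theorem gradient_comp {η : ℝ → ℝ} (hη : Differentiable ℝ η) (hφ : Differentiable ℝ φ) :
    gradient (η ∘ φ) = (deriv η ∘ φ) • gradient φ := by
  ext1 x
  simp [gradient, ((hη (φ x)).hasDerivAt.comp_hasFDerivAt x (hφ x).hasFDerivAt).fderiv]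

theorem gradient_eq_zero_of_notMem_tsupport {x : E} (hx : x ∉ tsupport φ) : gradient φ x = 0 := by
  simp [gradient, fderiv_of_notMem_tsupport ℝ hx]

theorem hasCompactSupport_gradient (hφ : HasCompactSupport φ) : HasCompactSupport (gradient φ) :=
  (hφ.fderiv (𝕜 := ℝ)).comp_left (map_zero (InnerProductSpace.toDual ℝ E).symm)

variable [MeasurableSpace E] [OpensMeasurableSpace E] [SecondCountableTopology E]

theorem isDerivation_gradient (μ : Measure E) : IsDerivation μ (gradient : (E → ℝ) → E → E) where
  aestronglyMeasurable hφ := (continuous_gradient hφ).aestronglyMeasurable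
  map_add hφ hψ := by
    ext1 x
    simp [gradient, fderiv_add (hφ.differentiable (by simp) x) (hψ.differentiable (by simp) x)]
  map_smul c _ hφ := by
    ext1 x
    simp [gradient, fderiv_const_smul (hφ.differentiable (by simp) x)]
  map_comp hη hφ := gradient_comp (hη.differentiable (by simp)) (hφ.differentiable (by simp))

end Gradient

section OutwardNormal

theorem sameRay_of_forall_inner_neg {H : Type*} [NormedAddCommGroup H] [InnerProductSpace ℝ H]
    {a b : H} (h : ∀ e : H, inner ℝ a e < 0 → inner ℝ b e ≤ 0) : SameRay ℝ a b := by
  rw [sameRay_iff_norm_smul_eq, eq_comm, ← inner_eq_norm_mul_iff_real]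
  refine le_antisymm (real_inner_le_norm a b) (not_lt.1 fun hlt ↦ ?_)
  have ha : 0 < ‖a‖ := norm_pos_iff.2 fun h₀ ↦ by simp [h₀] at hlt
  have hb : 0 < ‖b‖ := norm_pos_iff.2 fun h₀ ↦ by simp [h₀] at hlt
  have hae : inner ℝ a (‖a‖ • b - ‖b‖ • a) = ‖a‖ * (inner ℝ a b - ‖a‖ * ‖b‖) := by
    rw [inner_sub_right, real_inner_smul_right, real_inner_smul_right, real_inner_self_eq_norm_sq]
    ring
  have hbe : inner ℝ b (‖a‖ • b - ‖b‖ • a) = ‖b‖ * (‖a‖ * ‖b‖ - inner ℝ a b) := by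
    rw [inner_sub_right, real_inner_smul_right, real_inner_smul_right, real_inner_self_eq_norm_sq,
      real_inner_comm a b]
    ring
  have hle := h (‖a‖ • b - ‖b‖ • a) (hae ▸ mul_neg_of_pos_of_neg ha (sub_neg.2 hlt))
  exact hle.not_gt (hbe ▸ mul_pos hb (sub_pos.2 hlt))

variable {N : ℕ} {D U V : Set (EuclideanSpace ℝ (Fin N))} {r s : EuclideanSpace ℝ (Fin N) → ℝ}
  {x : EuclideanSpace ℝ (Fin N)}

/-- An open set lying locally on one side of its smooth boundary. -/
structure IsSmoothOpen (D : Set (EuclideanSpace ℝ (Fin N))) : Prop where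
  isOpen : IsOpen D
  smooth_boundary : ∀ x ∈ frontier D, ∃ U r, x ∈ U ∧ IsLocalDefiningFunction D U r

theorem IsSmoothBoundedDomain.isSmoothOpen (hD : IsSmoothBoundedDomain D) : IsSmoothOpen D :=
  ⟨hD.isOpen, hD.smooth_boundary⟩

theorem IsLocalDefiningFunction.eq_zero_of_mem_frontier (hr : IsLocalDefiningFunction D U r)
    (hD : IsOpen D) (hxU : x ∈ U) (hx : x ∈ frontier D) : r x = 0 := by
  rw [hD.frontier_eq] at hx
  refine le_antisymm (not_lt.1 fun hpos ↦ ?_) (not_lt.1 fun hneg ↦ hx.2 ((hr.mem_iff x hxU).2 hneg))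
  have hU : U ∈ 𝓝 x := hr.isOpen.mem_nhds hxU
  obtain ⟨y, ⟨hy, hyU⟩, hyD⟩ := mem_closure_iff_nhds.1 hx.1 _
    (inter_mem ((hr.contDiffOn.continuousOn.continuousAt hU).eventually_const_lt hpos) hU)
  exact lt_asymm hy ((hr.mem_iff y hyU).1 hyD)

theorem IsLocalDefiningFunction.deriv_line (hr : IsLocalDefiningFunction D U r) (hxU : x ∈ U)
    (e : EuclideanSpace ℝ (Fin N)) :
    deriv (fun t : ℝ ↦ r (x + t • e)) 0 = inner ℝ (gradient r x) e := by
  have hdiff : DifferentiableAt ℝ r x :=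
    (hr.contDiffOn.contDiffAt (hr.isOpen.mem_nhds hxU)).differentiableAt (by simp)
  rw [inner_gradient_left]
  exact (hdiff.hasFDerivAt.hasLineDerivAt e).lineDeriv

theorem IsLocalDefiningFunction.inner_gradient_nonpos (hr : IsLocalDefiningFunction D U r)
    (hs : IsLocalDefiningFunction D V s) (hD : IsOpen D) (hxU : x ∈ U) (hxV : x ∈ V)
    (hx : x ∈ frontier D) {e : EuclideanSpace ℝ (Fin N)} (he : inner ℝ (gradient r x) e < 0) :
    inner ℝ (gradient s x) e ≤ 0 := by
  by_contra! hpos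
  have hline : Tendsto (fun t : ℝ ↦ x + t • e) (𝓝 0) (𝓝 x) := by
    simpa using (show Continuous fun t : ℝ ↦ x + t • e by fun_prop).tendsto 0
  have hr_sign := eventually_nhdsWithin_sign_eq_of_deriv_neg ((hr.deriv_line hxU e).trans_lt he)
    (by simpa using hr.eq_zero_of_mem_frontier hD hxU hx)
  have hs_sign := eventually_nhdsWithin_sign_eq_of_deriv_pos
    (hpos.trans_eq (hs.deriv_line hxV e).symm) (by simpa using hs.eq_zero_of_mem_frontier hD hxV hx)
  have hev := hr_sign.and (hs_sign.and ((hline.eventually (hr.isOpen.mem_nhds hxU)).and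
    (hline.eventually (hs.isOpen.mem_nhds hxV))))
  obtain ⟨t, ⟨hrt, hst, htU, htV⟩, (ht : 0 < t)⟩ :=
    ((hev.filter_mono nhdsWithin_le_nhds).and (eventually_mem_nhdsWithin (s := Ioi 0))).exists
  rw [zero_sub, sign_neg (neg_neg_iff_pos.2 ht), sign_eq_neg_one_iff] at hrt
  rw [sub_zero, sign_pos ht, sign_eq_one_iff] at hst
  exact lt_asymm hst ((hs.mem_iff _ htV).1 ((hr.mem_iff _ htU).2 hrt))

theorem outwardNormal_eq (hr : IsLocalDefiningFunction D U r) (hD : IsOpen D) (hxU : x ∈ U)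
    (hx : x ∈ frontier D) : outwardNormal D x = ‖gradient r x‖⁻¹ • gradient r x := by
  have hex : ∃ ν, IsOutwardUnitNormal D x ν := ⟨_, hx, U, r, hxU, hr, rfl⟩
  obtain ⟨-, V, s, hxV, hs, hν⟩ := hex.choose_spec
  rw [outwardNormal, dif_pos hex, hν, ← sameRay_iff_inv_norm_smul_eq_of_ne
    (hs.gradient_ne_zero x hxV) (hr.gradient_ne_zero x hxU)]
  exact sameRay_of_forall_inner_neg fun e ↦ hs.inner_gradient_nonpos hr hD hxV hxU hx

theorem IsSmoothOpen.continuousOn_outwardNormal (hD : IsSmoothOpen D) :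
    ContinuousOn (outwardNormal D) (frontier D) := by
  intro x hx
  obtain ⟨U, r, hxU, hr⟩ := hD.smooth_boundary x hx
  have hU : U ∈ 𝓝 x := hr.isOpen.mem_nhds hxU
  have hgrad := (continuousOn_gradient hr.contDiffOn hr.isOpen).continuousAt hU
  have hnormalize : ContinuousAt (fun y ↦ ‖gradient r y‖⁻¹ • gradient r y) x :=
    (hgrad.norm.inv₀ (norm_ne_zero_iff.2 (hr.gradient_ne_zero x hxU))).smul hgrad
  refine hnormalize.continuousWithinAt.congr_of_eventuallyEq ?_
    (outwardNormal_eq hr hD.isOpen hxU hx)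
  filter_upwards [self_mem_nhdsWithin, mem_nhdsWithin_of_mem_nhds hU] with y hy hyU
  exact outwardNormal_eq hr hD.isOpen hyU hy

theorem IsDerivation.linearMap_comp {E F F' : Type*} [NormedAddCommGroup E] [NormedSpace ℝ E]
    [MeasurableSpace E] [NormedAddCommGroup F] [NormedSpace ℝ F] [NormedAddCommGroup F']
    [NormedSpace ℝ F'] {μ : Measure E} {G : (E → ℝ) → E → F} (hG : IsDerivation μ G)
    (L : E → F →ₗ[ℝ] F')
    (hL : ∀ φ, ContDiff ℝ ∞ φ → AEStronglyMeasurable (fun x ↦ L x (G φ x)) μ) :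
    IsDerivation μ fun φ x ↦ L x (G φ x) where
  aestronglyMeasurable hφ := hL _ hφ
  map_add hφ hψ := by
    ext1 x
    simp only [hG.map_add hφ hψ, Pi.add_apply, LinearMap.map_add]
  map_smul c _ hφ := by
    ext1 x
    simp only [hG.map_smul c hφ, Pi.smul_apply, LinearMap.map_smul]
  map_comp hη hφ := by
    ext1 x
    simp only [hG.map_comp hη hφ, Pi.smul_apply', LinearMap.map_smul]

theorem IsSmoothOpen.isDerivation_tangentialGradient (hD : IsSmoothOpen D) :
    IsDerivation (surfaceMeasure D) (tangentialGradient D) := by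
  let L (x : EuclideanSpace ℝ (Fin N)) : EuclideanSpace ℝ (Fin N) →ₗ[ℝ] EuclideanSpace ℝ (Fin N) :=
    LinearMap.id - (innerₗ _ (outwardNormal D x)).smulRight (outwardNormal D x)
  have hL : tangentialGradient D = fun φ x ↦ L x (gradient φ x) := by
    ext1 φ
    ext1 x
    simp [L, tangentialGradient]
  have hmeas (φ) (hφ : ContDiff ℝ ∞ φ) :
      AEStronglyMeasurable (tangentialGradient D φ) (surfaceMeasure D) :=
    have hgrad := (continuous_gradient hφ).continuousOn
    have hnormal := hD.continuousOn_outwardNormal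
    (hgrad.sub ((hgrad.inner (𝕜 := ℝ) hnormal).smul hnormal)).aestronglyMeasurable
      isClosed_frontier.measurableSet
  rw [hL] at hmeas ⊢
  exact (isDerivation_gradient _).linearMap_comp L hmeas

end OutwardNormal

section WeakGradient

theorem integral_smul_gradient_eq_neg {E : Type*} [NormedAddCommGroup E] [InnerProductSpace ℝ E]
    [FiniteDimensional ℝ E] [MeasurableSpace E] [BorelSpace E] {μ : Measure E} [μ.IsAddHaarMeasure]
    {φ θ : E → ℝ} (hφ : ContDiff ℝ ∞ φ) (hθ : ContDiff ℝ ∞ θ) (hc : HasCompactSupport θ) :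
    ∫ x, φ x • gradient θ x ∂μ = -∫ x, θ x • gradient φ x ∂μ := by
  have hφθ' : Integrable (fun x ↦ φ x • gradient θ x) μ :=
    (hφ.continuous.smul (continuous_gradient hθ)).integrable_of_hasCompactSupport
      (hasCompactSupport_gradient hc).smul_left
  have hθφ' : Integrable (fun x ↦ θ x • gradient φ x) μ :=
    (hθ.continuous.smul (continuous_gradient hφ)).integrable_of_hasCompactSupport hc.smul_right
  refine ext_inner_left ℝ fun e ↦ ?_
  rw [inner_neg_right, ← integral_inner hφθ', ← integral_inner hθφ']
  have hφθ'_inner := hφθ'.const_inner (𝕜 := ℝ) e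
  have hθφ'_inner := hθφ'.const_inner (𝕜 := ℝ) e
  simp only [real_inner_smul_right, inner_gradient_right, conj_trivial] at hφθ'_inner hθφ'_inner ⊢
  simp only [mul_comm (θ _)] at hθφ'_inner ⊢
  exact integral_mul_fderiv_eq_neg_fderiv_mul_of_integrable hθφ'_inner hφθ'_inner
    ((hφ.continuous.mul hθ.continuous).integrable_of_hasCompactSupport hc.mul_left)
    (fun x _ ↦ hφ.differentiable (by simp) x) (fun x _ ↦ hθ.differentiable (by simp) x)

theorem tendsto_integral_bilin_of_tendsto_eLpNorm {α ι E F G : Type*} [MeasurableSpace α]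
    {μ : Measure α} [NormedAddCommGroup E] [NormedSpace ℝ E] [NormedAddCommGroup F]
    [NormedSpace ℝ F] [NormedAddCommGroup G] [NormedSpace ℝ G] {l : Filter ι} {p q : ℝ≥0∞}
    [p.HolderConjugate q] (B : E →L[ℝ] F →L[ℝ] G) {f : ι → α → E} {f₀ : α → E} {g : α → F}
    (hf : ∀ n, AEStronglyMeasurable (f n) μ) (hf₀ : MemLp f₀ p μ) (hg : MemLp g q μ)
    (h : Tendsto (fun n ↦ eLpNorm (f n - f₀) p μ) l (𝓝 0)) :
    Tendsto (fun n ↦ ∫ x, B (f n x) (g x) ∂μ) l (𝓝 (∫ x, B (f₀ x) (g x) ∂μ)) := by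
  have hbound (k : α → E) : ∀ᵐ x ∂μ, ‖B (k x) (g x)‖₊ ≤ ‖B‖₊ * ‖k x‖₊ * ‖g x‖₊ :=
    .of_forall fun x ↦ B.le_opNorm₂ (k x) (g x)
  have hint {k : α → E} (hk : MemLp k p μ) : Integrable (fun x ↦ B (k x) (g x)) μ :=
    memLp_one_iff_integrable.1 <| MemLp.of_bilin (B · ·) ‖B‖₊ hk hg
      (B.aestronglyMeasurable_comp₂ hk.1 hg.1) (hbound k)
  have hmem : ∀ᶠ n in l, MemLp (f n) p μ := (h.eventually_lt_const zero_lt_one).mono fun n hn ↦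
    memLp_of_eLpNorm_sub_lt_top hf₀ (hf n) (hn.trans_le le_top)
  refine tendsto_integral_of_L1' _ (hint hf₀).1 (hmem.mono fun n hn ↦ hint hn) ?_
  refine tendsto_of_tendsto_of_tendsto_of_le_of_le tendsto_const_nhds (h := fun n ↦
    ‖B‖₊ * eLpNorm (f n - f₀) p μ * eLpNorm g q μ) ?_ (fun n ↦ zero_le) fun n ↦ ?_
  · simpa only [mul_zero, zero_mul] using ENNReal.Tendsto.mul_const
      (ENNReal.Tendsto.const_mul h (.inr ENNReal.coe_ne_top)) (.inr hg.2.ne)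
  · have hsub : (fun x ↦ B (f n x) (g x)) - (fun x ↦ B (f₀ x) (g x))
        = fun x ↦ B ((f n - f₀) x) (g x) := by
      ext x
      simp only [Pi.sub_apply, map_sub, sub_apply]
    rw [hsub]
    exact eLpNorm_le_eLpNorm_mul_eLpNorm_of_nnnorm ((hf n).sub hf₀.1) hg.1 (B · ·) ‖B‖₊ (hbound _)

variable {N : ℕ} {D : Set (EuclideanSpace ℝ (Fin N))}

instance : IsLocallyFiniteMeasure (bulkMeasure D) :=
  inferInstanceAs (IsLocallyFiniteMeasure (volume.restrict D))

theorem integral_bulkMeasure_smul_gradient_eq_neg {φ θ : EuclideanSpace ℝ (Fin N) → ℝ}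
    (hφ : ContDiff ℝ ∞ φ) (hθ : ContDiff ℝ ∞ θ) (hc : HasCompactSupport θ) (hθD : tsupport θ ⊆ D) :
    ∫ x, φ x • gradient θ x ∂(bulkMeasure D) = -∫ x, θ x • gradient φ x ∂(bulkMeasure D) := by
  rw [bulkMeasure, setIntegral_eq_integral_of_forall_compl_eq_zero fun x hx ↦ ?_,
    setIntegral_eq_integral_of_forall_compl_eq_zero fun x hx ↦ ?_,
    integral_smul_gradient_eq_neg hφ hθ hc]
  · rw [image_eq_zero_of_notMem_tsupport fun h ↦ hx (hθD h), zero_smul]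
  · rw [gradient_eq_zero_of_notMem_tsupport fun h ↦ hx (hθD h), smul_zero]

theorem IsSmoothLimit.isWeakGradient {ν : Measure (EuclideanSpace ℝ (Fin N))}
    {u v : EuclideanSpace ℝ (Fin N) → ℝ} {p : EuclideanSpace ℝ (Fin N) → EuclideanSpace ℝ (Fin N)}
    (h : IsSmoothLimit (bulkMeasure D) ν gradient u p v) (hu : MemLp u 2 (bulkMeasure D))
    (hp : MemLp p 2 (bulkMeasure D)) : IsWeakGradient D u p := by
  obtain ⟨φ, hφ, hφu, hφp, -⟩ := h
  refine ⟨hu, hp, fun θ hθ hc hθD ↦ ?_⟩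
  have hθ₂ : MemLp θ 2 (bulkMeasure D) := hθ.continuous.memLp_of_hasCompactSupport hc
  have hθ₂' : MemLp (gradient θ) 2 (bulkMeasure D) :=
    (continuous_gradient hθ).memLp_of_hasCompactSupport (hasCompactSupport_gradient hc)
  let B : ℝ →L[ℝ] EuclideanSpace ℝ (Fin N) →L[ℝ] EuclideanSpace ℝ (Fin N) := .lsmul ℝ ℝ
  have hleft := tendsto_integral_bilin_of_tendsto_eLpNorm B
    (fun n ↦ (hφ n).continuous.aestronglyMeasurable) hu hθ₂' hφu
  have hright := tendsto_integral_bilin_of_tendsto_eLpNorm B.flip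
    (fun n ↦ (continuous_gradient (hφ n)).aestronglyMeasurable) hp hθ₂ hφp
  exact tendsto_nhds_unique (hleft.congr fun n ↦
    integral_bulkMeasure_smul_gradient_eq_neg (hφ n) hθ hc hθD) hright.neg

theorem IsWeakGradient.ae_eq (hD : IsOpen D) {u : EuclideanSpace ℝ (Fin N) → ℝ}
    {p q : EuclideanSpace ℝ (Fin N) → EuclideanSpace ℝ (Fin N)} (hp : IsWeakGradient D u p)
    (hq : IsWeakGradient D u q) : p =ᵐ[bulkMeasure D] q := by
  have hpq : LocallyIntegrable (p - q) (bulkMeasure D) :=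
    (hp.memLp_gradient.sub hq.memLp_gradient).locallyIntegrable one_le_two
  have hzero := hD.ae_eq_zero_of_integral_contDiff_smul_eq_zero (hpq.locallyIntegrableOn D)
    fun θ hθ hc hθD ↦ ?_
  · filter_upwards [hzero, ae_restrict_mem hD.measurableSet] with x hx hxD
    exact sub_eq_zero.1 (hx hxD)
  · have hint {r : EuclideanSpace ℝ (Fin N) → EuclideanSpace ℝ (Fin N)}
        (hr : MemLp r 2 (bulkMeasure D)) : Integrable (fun x ↦ θ x • r x) (bulkMeasure D) :=
      memLp_one_iff_integrable.1 (hr.smul (hθ.continuous.memLp_of_hasCompactSupport (p := 2) hc))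
    simp only [Pi.sub_apply, smul_sub]
    rw [integral_sub (hint hp.memLp_gradient) (hint hq.memLp_gradient), sub_eq_zero, ← neg_inj,
      ← hp.integral_eq θ hθ hc hθD, ← hq.integral_eq θ hθ hc hθD]

end WeakGradient

section FormDomain

variable {N : ℕ} {D : Set (EuclideanSpace ℝ (Fin N))} {ε : ℝ}
  {u v u' v' : EuclideanSpace ℝ (Fin N) → ℝ}
  {p w p' w' : EuclideanSpace ℝ (Fin N) → EuclideanSpace ℝ (Fin N)}

theorem isSurfaceGradient_iff :
    IsSurfaceGradient D v w ↔ MemLp v 2 (surfaceMeasure D) ∧ MemLp w 2 (surfaceMeasure D) ∧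
      IsSmoothLimit (surfaceMeasure D) (surfaceMeasure D) (tangentialGradient D) v w v :=
  and_congr_right' <| and_congr_right' ⟨fun ⟨φ, hφ, hv, hw⟩ ↦ ⟨φ, hφ, hv, hw, hv⟩,
    fun ⟨φ, hφ, hv, hw, _⟩ ↦ ⟨φ, hφ, hv, hw⟩⟩

theorem memVWithGradients_iff (hD : IsOpen D) :
    MemVWithGradients D ε u v p w ↔ MemLp u 2 (bulkMeasure D) ∧ MemLp v 2 (surfaceMeasure D) ∧
      MemLp p 2 (bulkMeasure D) ∧
      IsSmoothLimit (bulkMeasure D) (surfaceMeasure D) gradient u p v ∧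
      (0 < ε → MemLp w 2 (surfaceMeasure D) ∧
        IsSmoothLimit (surfaceMeasure D) (surfaceMeasure D) (tangentialGradient D) v w v) := by
  constructor
  · rintro ⟨⟨-, -, hv, p', hp', htrace⟩, hp, hw⟩
    exact ⟨hp.memLp, hv, hp.memLp_gradient,
      IsSmoothLimit.congr_ae htrace .rfl (hp'.ae_eq hD hp) .rfl,
      fun hε ↦ (isSurfaceGradient_iff.1 (hw hε)).2⟩
  · rintro ⟨hu, hv, hp, hlim, hw⟩
    have hgrad := hlim.isWeakGradient hu hp
    have hsurf (hε : 0 < ε) : IsSurfaceGradient D v w := isSurfaceGradient_iff.2 ⟨hv, hw hε⟩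
    have htrace : IsTrace D u v := ⟨hv, p, hgrad, hlim⟩
    exact ⟨⟨⟨p, hgrad⟩, ⟨fun hε ↦ ⟨w, hsurf hε⟩, fun _ ↦ ⟨u, ⟨p, hgrad⟩, htrace⟩⟩, htrace⟩,
      hgrad, hsurf⟩

theorem MemVWithGradients.congr_ae (hD : IsOpen D) (h : MemVWithGradients D ε u v p w)
    (hu : u =ᵐ[bulkMeasure D] u') (hv : v =ᵐ[surfaceMeasure D] v')
    (hp : p =ᵐ[bulkMeasure D] p') (hw : 0 < ε → w =ᵐ[surfaceMeasure D] w') :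
    MemVWithGradients D ε u' v' p' w' := by
  rw [memVWithGradients_iff hD] at h ⊢
  obtain ⟨hu₂, hv₂, hp₂, hbulk, hsurf⟩ := h
  exact ⟨hu₂.ae_eq hu, hv₂.ae_eq hv, hp₂.ae_eq hp, hbulk.congr_ae hu hp hv, fun hε ↦
    ⟨(hsurf hε).1.ae_eq (hw hε), (hsurf hε).2.congr_ae hv (hw hε) hv⟩⟩

theorem memLp_deriv_comp_smul {α F : Type*} [MeasurableSpace α] {μ : Measure α}
    [NormedAddCommGroup F] [NormedSpace ℝ F] {r : ℝ≥0∞} {η : ℝ → ℝ} {C : NNReal}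
    (hη : ContDiff ℝ 1 η) (hηC : LipschitzWith C η) {f : α → ℝ} {g : α → F}
    (hf : AEStronglyMeasurable f μ) (hg : MemLp g r μ) : MemLp ((deriv η ∘ f) • g) r μ :=
  hg.of_le_mul (c := C)
    (((hη.continuous_deriv le_rfl).comp_aestronglyMeasurable hf).smul hg.1)
    (Eventually.of_forall fun _ ↦ (norm_smul _ _).trans_le
      (mul_le_mul_of_nonneg_right (norm_deriv_le_of_lipschitz hηC) (norm_nonneg _)))

theorem MemVWithGradients.comp (hD : IsSmoothOpen D) (h : MemVWithGradients D ε u v p w)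
    {η : ℝ → ℝ} {C : NNReal} (hη : ContDiff ℝ ∞ η) (hηC : LipschitzWith C η) (hη₀ : η 0 = 0) :
    MemVWithGradients D ε (η ∘ u) (η ∘ v) ((deriv η ∘ u) • p) ((deriv η ∘ v) • w) := by
  rw [memVWithGradients_iff hD.isOpen] at h ⊢
  obtain ⟨hu, hv, hp, hbulk, hsurf⟩ := h
  have hη₁ : ContDiff ℝ 1 η := hη.of_le (by simp)
  exact ⟨hηC.comp_memLp hη₀ hu, hηC.comp_memLp hη₀ hv, memLp_deriv_comp_smul hη₁ hηC hu.1 hp,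
    hbulk.comp (isDerivation_gradient _) hu.1 hp hη hηC,
    fun hε ↦ ⟨memLp_deriv_comp_smul hη₁ hηC hv.1 (hsurf hε).1,
      (hsurf hε).2.comp hD.isDerivation_tangentialGradient hv.1 (hsurf hε).1 hη hηC⟩⟩

end FormDomain

section EnergySpace

variable {N : ℕ} {D : Set (EuclideanSpace ℝ (Fin N))} {ε δ : ℝ}
  {u v φ ψ : EuclideanSpace ℝ (Fin N) → ℝ}
  {p w q z : EuclideanSpace ℝ (Fin N) → EuclideanSpace ℝ (Fin N)}

/-- The Hilbert space `L²(D) × L²(Γ)`. -/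
abbrev L2Space (D : Set (EuclideanSpace ℝ (Fin N))) : Type :=
  WithLp 2 (Lp ℝ 2 (bulkMeasure D) × Lp ℝ 2 (surfaceMeasure D))

/-- The Hilbert space `(L²(D) × L²(Γ)) × (L²(D; ℝ^N) × L²(Γ; ℝ^N))`, in which `(u, v) ∈ 𝒱_ε` is
represented by `((u, v), (√δ ∇u, √(δε) ∇_Γ v))`: the inner product then restricts on `𝒱_ε` to the
bilinear form of `I + δ 𝒞_ε`. -/
abbrev EnergySpace (D : Set (EuclideanSpace ℝ (Fin N))) : Type :=
  WithLp 2 (L2Space D × WithLp 2 (Lp (EuclideanSpace ℝ (Fin N)) 2 (bulkMeasure D) ×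
    Lp (EuclideanSpace ℝ (Fin N)) 2 (surfaceMeasure D)))

/-- The map `((u, v), (P, W)) ↦ (u, P / √δ, v)` recovering the weak gradient of `u`. -/
def bulkTriple (D : Set (EuclideanSpace ℝ (Fin N))) (δ : ℝ) :
    EnergySpace D →L[ℝ] Lp ℝ 2 (bulkMeasure D) × Lp (EuclideanSpace ℝ (Fin N)) 2 (bulkMeasure D) ×
      Lp ℝ 2 (surfaceMeasure D) :=
  (WithLp.fstL 2 ℝ _ _ ∘L WithLp.fstL 2 ℝ _ _).prod
    (((√δ)⁻¹ • (WithLp.fstL 2 ℝ _ _ ∘L WithLp.sndL 2 ℝ _ _)).prod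
      (WithLp.sndL 2 ℝ _ _ ∘L WithLp.fstL 2 ℝ _ _))

/-- The map `((u, v), (P, W)) ↦ (v, W / √(δε), v)` recovering the surface gradient of `v`. -/
def surfaceTriple (D : Set (EuclideanSpace ℝ (Fin N))) (ε δ : ℝ) :
    EnergySpace D →L[ℝ] Lp ℝ 2 (surfaceMeasure D) ×
      Lp (EuclideanSpace ℝ (Fin N)) 2 (surfaceMeasure D) × Lp ℝ 2 (surfaceMeasure D) :=
  (WithLp.sndL 2 ℝ _ _ ∘L WithLp.fstL 2 ℝ _ _).prod
    (((√(δ * ε))⁻¹ • (WithLp.sndL 2 ℝ _ _ ∘L WithLp.sndL 2 ℝ _ _)).prod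
      (WithLp.sndL 2 ℝ _ _ ∘L WithLp.fstL 2 ℝ _ _))

/-- The space `𝒱_ε` as a closed subspace of the energy space. If `ε = 0`, the last component of its
elements is unconstrained. -/
def formDomain (hD : IsSmoothOpen D) (ε δ : ℝ) : ClosedSubmodule ℝ (EnergySpace D) :=
  (smoothGraph (isDerivation_gradient (bulkMeasure D)) (surfaceMeasure D)).closure.comap
      (bulkTriple D δ) ⊓
    ⨅ _ : 0 < ε, (smoothGraph hD.isDerivation_tangentialGradient
      (surfaceMeasure D)).closure.comap (surfaceTriple D ε δ)

theorem mem_formDomain_iff (hD : IsSmoothOpen D) {X : EnergySpace D} :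
    X ∈ formDomain hD ε δ ↔ MemVWithGradients D ε X.fst.fst X.fst.snd
      ((√δ)⁻¹ • X.snd.fst : Lp _ 2 _) ((√(δ * ε))⁻¹ • X.snd.snd : Lp _ 2 _) := by
  simp only [formDomain, ClosedSubmodule.mem_inf, ClosedSubmodule.mem_iInf,
    ClosedSubmodule.mem_comap, Submodule.mem_closure_iff, mem_topologicalClosure_smoothGraph_iff,
    memVWithGradients_iff hD.isOpen]
  exact ⟨fun ⟨hbulk, hsurf⟩ ↦ ⟨Lp.memLp _, Lp.memLp _, Lp.memLp _, hbulk,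
    fun hε ↦ ⟨Lp.memLp _, hsurf hε⟩⟩, fun ⟨_, _, _, hbulk, hsurf⟩ ↦ ⟨hbulk, fun hε ↦ (hsurf hε).2⟩⟩

/-- The vector of the energy space that represents `(u, v)` with gradients `p = ∇u` and
`w = ∇_Γ v`. -/
def IsEnergyVector (ε δ : ℝ) (X : EnergySpace D) (u v : EuclideanSpace ℝ (Fin N) → ℝ)
    (p w : EuclideanSpace ℝ (Fin N) → EuclideanSpace ℝ (Fin N)) : Prop :=
  X.fst.fst =ᵐ[bulkMeasure D] u ∧ X.fst.snd =ᵐ[surfaceMeasure D] v ∧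
    X.snd.fst =ᵐ[bulkMeasure D] √δ • p ∧ X.snd.snd =ᵐ[surfaceMeasure D] √(δ * ε) • w

theorem inv_smul_ae_eq_of_ae_eq_smul {α H : Type*} [MeasurableSpace α] {μ : Measure α}
    [NormedAddCommGroup H] [NormedSpace ℝ H] {r : ℝ≥0∞} {F : Lp H r μ} {f : α → H} {c : ℝ}
    (hc : c ≠ 0) (hF : F =ᵐ[μ] c • f) : (c⁻¹ • F : Lp H r μ) =ᵐ[μ] f := by
  simpa only [inv_smul_smul₀ hc] using (Lp.coeFn_smul _ _).trans (hF.const_smul c⁻¹)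

theorem MemVWithGradients.exists_isEnergyVector (hD : IsSmoothOpen D) (hε : 0 ≤ ε) (hδ : 0 < δ)
    (h : MemVWithGradients D ε u v p w) :
    ∃ X ∈ formDomain hD ε δ, IsEnergyVector ε δ X u v p w := by
  obtain ⟨hu, hv, hp, -, hsurf⟩ := (memVWithGradients_iff hD.isOpen).1 h
  have hp' : MemLp (√δ • p) 2 (bulkMeasure D) := hp.const_smul _
  have hw' : MemLp (√(δ * ε) • w) 2 (surfaceMeasure D) := by
    rcases hε.eq_or_lt with rfl | hε
    · simp only [mul_zero, Real.sqrt_zero, zero_smul, MemLp.zero]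
    · exact (hsurf hε).1.const_smul _
  refine ⟨.toLp 2 (.toLp 2 (hu.toLp, hv.toLp), .toLp 2 (hp'.toLp, hw'.toLp)),
    (mem_formDomain_iff hD).2 (h.congr_ae hD.isOpen hu.coeFn_toLp.symm hv.coeFn_toLp.symm ?_
      fun hε ↦ ?_), hu.coeFn_toLp, hv.coeFn_toLp, hp'.coeFn_toLp, hw'.coeFn_toLp⟩
  · exact (inv_smul_ae_eq_of_ae_eq_smul (Real.sqrt_pos.2 hδ).ne' hp'.coeFn_toLp).symm
  · exact (inv_smul_ae_eq_of_ae_eq_smul (Real.sqrt_pos.2 (mul_pos hδ hε)).ne' hw'.coeFn_toLp).symm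

theorem inner_toLp_eq_integral {α H : Type*} [MeasurableSpace α] {μ : Measure α}
    [NormedAddCommGroup H] [InnerProductSpace ℝ H] {F G : Lp H 2 μ} {g : α → H} (hG : G =ᵐ[μ] g) :
    inner ℝ F G = ∫ x, inner ℝ (F x) (g x) ∂μ := by
  rw [L2.inner_def]
  exact integral_congr_ae (hG.mono fun x hx ↦ congrArg _ hx)

theorem inner_eq_mul_integral_of_ae_eq_sqrt_smul {α H : Type*} [MeasurableSpace α] {μ : Measure α}
    [NormedAddCommGroup H] [InnerProductSpace ℝ H] {F G : Lp H 2 μ} {g : α → H} {c : ℝ}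
    (hG : G =ᵐ[μ] √c • g) :
    inner ℝ F G = c * ∫ x, inner ℝ (((√c)⁻¹ • F : Lp H 2 μ) x) (g x) ∂μ := by
  rw [inner_toLp_eq_integral hG, ← integral_const_mul]
  refine integral_congr_ae ((Lp.coeFn_smul (√c)⁻¹ F).mono fun x hx ↦ ?_)
  dsimp only
  rw [hx, Pi.smul_apply, Pi.smul_apply, real_inner_smul_left, real_inner_smul_right, ← mul_assoc,
    ← div_eq_mul_inv, Real.div_sqrt]

theorem L2Space.inner_eq_integral {F U : L2Space D} (hφ : U.fst =ᵐ[bulkMeasure D] φ)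
    (hψ : U.snd =ᵐ[surfaceMeasure D] ψ) : inner ℝ F U
      = ∫ x, F.fst x * φ x ∂(bulkMeasure D) + ∫ x, F.snd x * ψ x ∂(surfaceMeasure D) := by
  rw [WithLp.prod_inner_apply, WithLp.ofLp_fst, WithLp.ofLp_fst, WithLp.ofLp_snd, WithLp.ofLp_snd,
    inner_toLp_eq_integral hφ, inner_toLp_eq_integral hψ]
  simp only [RCLike.inner_apply', conj_trivial]

theorem IsEnergyVector.inner_eq {X Y : EnergySpace D} (hY : IsEnergyVector ε δ Y φ ψ q z) :
    inner ℝ X Y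
      = (∫ x, X.fst.fst x * φ x ∂(bulkMeasure D) + ∫ x, X.fst.snd x * ψ x ∂(surfaceMeasure D))
        + δ * (∫ x, inner ℝ (((√δ)⁻¹ • X.snd.fst : Lp _ 2 _) x) (q x) ∂(bulkMeasure D)
          + ε * ∫ x, inner ℝ (((√(δ * ε))⁻¹ • X.snd.snd : Lp _ 2 _) x) (z x)
            ∂(surfaceMeasure D)) := by
  obtain ⟨hφ, hψ, hq, hz⟩ := hY
  rw [mul_add, ← mul_assoc, ← inner_eq_mul_integral_of_ae_eq_sqrt_smul hq,
    ← inner_eq_mul_integral_of_ae_eq_sqrt_smul hz, ← L2Space.inner_eq_integral hφ hψ]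
  rfl

end EnergySpace

section ResolventL2

variable {N : ℕ} {D : Set (EuclideanSpace ℝ (Fin N))} {ε δ : ℝ}
  {f g u v f' g' u' v' : EuclideanSpace ℝ (Fin N) → ℝ}

theorem integral_mul_eq_add_of_ae_eq_add_smul {α : Type*} [MeasurableSpace α] {μ : Measure α}
    {f u a φ : α → ℝ} {c : ℝ} (hu : MemLp u 2 μ) (ha : MemLp a 2 μ) (hφ : MemLp φ 2 μ)
    (hf : ∀ᵐ x ∂μ, u x + c * a x = f x) :
    ∫ x, f x * φ x ∂μ = ∫ x, u x * φ x ∂μ + c * ∫ x, a x * φ x ∂μ := by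
  have huφ : Integrable (fun x ↦ u x * φ x) μ := hu.integrable_mul hφ
  have haφ : Integrable (fun x ↦ a x * φ x) μ := ha.integrable_mul hφ
  rw [← integral_const_mul, ← integral_add huφ (haφ.const_mul c)]
  refine integral_congr_ae (hf.mono fun x hx ↦ ?_)
  dsimp only
  rw [← hx, add_mul, mul_assoc]

theorem isResolventL2_iff (hD : IsOpen D) (hδ : 0 < δ) (hf : MemLp f 2 (bulkMeasure D))
    (hg : MemLp g 2 (surfaceMeasure D)) :
    IsResolventL2 D ε δ f g u v ↔ ∃ p w, MemVWithGradients D ε u v p w ∧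
      ∀ φ ψ q z, MemVWithGradients D ε φ ψ q z →
        (∫ x, u x * φ x ∂(bulkMeasure D) + ∫ x, v x * ψ x ∂(surfaceMeasure D))
          + δ * (∫ x, inner ℝ (p x) (q x) ∂(bulkMeasure D)
            + ε * ∫ x, inner ℝ (w x) (z x) ∂(surfaceMeasure D))
        = ∫ x, f x * φ x ∂(bulkMeasure D) + ∫ x, g x * ψ x ∂(surfaceMeasure D) := by
  have hsplit {a b φ ψ q z} (hu : MemLp u 2 (bulkMeasure D)) (hv : MemLp v 2 (surfaceMeasure D))
      (ha : MemLp a 2 (bulkMeasure D)) (hb : MemLp b 2 (surfaceMeasure D))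
      (haf : ∀ᵐ x ∂(bulkMeasure D), u x + δ * a x = f x)
      (hbg : ∀ᵐ x ∂(surfaceMeasure D), v x + δ * b x = g x)
      (hφ : MemVWithGradients D ε φ ψ q z) :
      ∫ x, f x * φ x ∂(bulkMeasure D) + ∫ x, g x * ψ x ∂(surfaceMeasure D)
        = (∫ x, u x * φ x ∂(bulkMeasure D) + ∫ x, v x * ψ x ∂(surfaceMeasure D))
          + δ * (∫ x, a x * φ x ∂(bulkMeasure D) + ∫ x, b x * ψ x ∂(surfaceMeasure D)) := by
    obtain ⟨hφ₂, hψ₂, -⟩ := (memVWithGradients_iff hD).1 hφ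
    rw [integral_mul_eq_add_of_ae_eq_add_smul hu ha hφ₂ haf,
      integral_mul_eq_add_of_ae_eq_add_smul hv hb hψ₂ hbg]
    ring
  constructor
  · rintro ⟨a, b, ⟨ha, hb, p, w, h, htest⟩, haf, hbg⟩
    obtain ⟨hu, hv, -⟩ := (memVWithGradients_iff hD).1 h
    refine ⟨p, w, h, fun φ ψ q z hφ ↦ ?_⟩
    rw [htest φ ψ q z hφ, hsplit hu hv ha hb haf hbg hφ]
  · rintro ⟨p, w, h, htest⟩
    obtain ⟨hu, hv, -⟩ := (memVWithGradients_iff hD).1 h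
    have ha : MemLp (δ⁻¹ • (f - u)) 2 (bulkMeasure D) := (hf.sub hu).const_smul _
    have hb : MemLp (δ⁻¹ • (g - v)) 2 (surfaceMeasure D) := (hg.sub hv).const_smul _
    have hcancel (s t : ℝ) : t + δ * (δ⁻¹ * (s - t)) = s := by
      rw [mul_inv_cancel_left₀ hδ.ne', add_sub_cancel]
    have haf := ae_of_all (bulkMeasure D) fun x ↦ hcancel (f x) (u x)
    have hbg := ae_of_all (surfaceMeasure D) fun x ↦ hcancel (g x) (v x)
    refine ⟨_, _, ⟨ha, hb, p, w, h, fun φ ψ q z hφ ↦ ?_⟩, haf, hbg⟩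
    have := htest φ ψ q z hφ
    rwa [hsplit hu hv ha hb haf hbg hφ, add_right_inj, mul_right_inj' hδ.ne'] at this

theorem IsResolventL2.congr_ae (hD : IsOpen D) (h : IsResolventL2 D ε δ f g u v)
    (hf : f =ᵐ[bulkMeasure D] f') (hg : g =ᵐ[surfaceMeasure D] g') (hu : u =ᵐ[bulkMeasure D] u')
    (hv : v =ᵐ[surfaceMeasure D] v') : IsResolventL2 D ε δ f' g' u' v' := by
  obtain ⟨a, b, ⟨ha, hb, p, w, h, htest⟩, haf, hbg⟩ := h
  refine ⟨a, b, ⟨ha, hb, p, w, h.congr_ae hD hu hv .rfl fun _ ↦ .rfl, htest⟩, ?_, ?_⟩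
  · filter_upwards [haf, hf, hu] with x hx hfx hux
    rw [← hfx, ← hux, hx]
  · filter_upwards [hbg, hg, hv] with x hx hgx hvx
    rw [← hgx, ← hvx, hx]

/-- The resolvent `(I + δ 𝒞_ε)⁻¹` on `L²(D) × L²(Γ)`, as the compression of the orthogonal
projection onto `𝒱_ε` in the energy space. -/
def resolventL2 (hD : IsSmoothOpen D) (ε δ : ℝ) : L2Space D →L[ℝ] L2Space D :=
  WithLp.fstL 2 ℝ _ _ ∘L (formDomain hD ε δ).toSubmodule.starProjection ∘L
    ContinuousLinearMap.adjoint (WithLp.fstL 2 ℝ _ _)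

theorem isResolventL2_resolventL2 (hD : IsSmoothOpen D) (hε : 0 ≤ ε) (hδ : 0 < δ) (F : L2Space D) :
    IsResolventL2 D ε δ F.fst F.snd (resolventL2 hD ε δ F).fst (resolventL2 hD ε δ F).snd := by
  let K := (formDomain hD ε δ).toSubmodule
  let F' : EnergySpace D := ContinuousLinearMap.adjoint (WithLp.fstL 2 ℝ _ _) F
  have hmem : K.starProjection F' ∈ formDomain hD ε δ := K.starProjection_apply_mem F'
  refine (isResolventL2_iff hD.isOpen hδ (Lp.memLp _) (Lp.memLp _)).2
    ⟨_, _, (mem_formDomain_iff hD).1 hmem, fun φ ψ q z hφ ↦ ?_⟩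
  obtain ⟨Y, hY, hYφ⟩ := hφ.exists_isEnergyVector hD hε hδ
  have horth : inner ℝ (F' - K.starProjection F') Y = 0 :=
    K.starProjection_inner_eq_zero F' Y hY
  rw [inner_sub_left, ContinuousLinearMap.adjoint_inner_left, sub_eq_zero, hYφ.inner_eq] at horth
  exact horth.symm.trans (L2Space.inner_eq_integral hYφ.1 hYφ.2.1)

theorem IsResolventL2.ae_eq_resolventL2 (hD : IsSmoothOpen D) (hε : 0 ≤ ε) (hδ : 0 < δ)
    {F : L2Space D} (h : IsResolventL2 D ε δ F.fst F.snd u v) :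
    u =ᵐ[bulkMeasure D] (resolventL2 hD ε δ F).fst ∧
      v =ᵐ[surfaceMeasure D] (resolventL2 hD ε δ F).snd := by
  obtain ⟨p, w, h, htest⟩ := (isResolventL2_iff hD.isOpen hδ (Lp.memLp _) (Lp.memLp _)).1 h
  obtain ⟨X, hX, hXu⟩ := h.exists_isEnergyVector hD hε hδ
  let K := (formDomain hD ε δ).toSubmodule
  have hproj : K.starProjection (ContinuousLinearMap.adjoint (WithLp.fstL 2 ℝ _ _) F) = X := by
    refine K.eq_starProjection_of_mem_of_inner_eq_zero hX fun Y hY ↦ ?_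
    rw [inner_sub_left, ContinuousLinearMap.adjoint_inner_left, sub_eq_zero, real_inner_comm,
      real_inner_comm Y X, hXu.inner_eq]
    have := htest _ _ _ _ ((mem_formDomain_iff hD).1 hY)
    simp only [mul_comm (u _), mul_comm (v _), real_inner_comm _ (p _),
      real_inner_comm _ (w _)] at this
    rw [this, real_inner_comm]
    exact L2Space.inner_eq_integral .rfl .rfl
  have hfst : resolventL2 hD ε δ F = X.fst := congrArg WithLp.fst hproj
  rw [hfst]
  exact ⟨hXu.1.symm, hXu.2.1.symm⟩

end ResolventL2

section Truncation

variable {α : Type*} [MeasurableSpace α] {μ : Measure α} {f u : α → ℝ} {M : ℝ} {k : ℕ}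

theorem exists_lipschitzWith_smoothTransition : ∃ C, LipschitzWith C Real.smoothTransition := by
  obtain ⟨C, hC⟩ := (Real.smoothTransition.contDiff (n := 1)).locallyLipschitz.locallyLipschitzOn
    |>.exists_lipschitzOnWith_of_compact (isCompact_Icc (a := (0 : ℝ)) (b := 1))
  have hproj : Real.smoothTransition
      = (Icc (0 : ℝ) 1).domRestrict Real.smoothTransition ∘ projIcc 0 1 zero_le_one :=
    funext fun x ↦ Real.smoothTransition.projIcc.symm
  rw [hproj]
  exact ⟨_, hC.to_restrict.comp (LipschitzWith.projIcc zero_le_one)⟩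

/-- A smooth approximation, for large `k`, of the indicator function of `(M, ∞)`. -/
def cutoff (M : ℝ) (k : ℕ) (s : ℝ) : ℝ :=
  Real.smoothTransition (k * (s - M))

theorem contDiff_cutoff (M : ℝ) (k : ℕ) : ContDiff ℝ ∞ (cutoff M k) :=
  Real.smoothTransition.contDiff.comp (contDiff_const.mul (contDiff_id.sub contDiff_const))

theorem exists_lipschitzWith_cutoff (M : ℝ) (k : ℕ) : ∃ C, LipschitzWith C (cutoff M k) := by
  obtain ⟨C, hC⟩ := exists_lipschitzWith_smoothTransition
  have haff : LipschitzWith k fun s : ℝ ↦ k * (s - M) :=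
    LipschitzWith.of_dist_le_mul fun s t ↦ by
      rw [Real.dist_eq, ← mul_sub, sub_sub_sub_cancel_right, abs_mul, Nat.abs_cast]
      rfl
  exact ⟨_, hC.comp haff⟩

theorem monotone_cutoff (M : ℝ) (k : ℕ) : Monotone (cutoff M k) := fun _ _ hst ↦
  Real.smoothTransition.monotone
    (mul_le_mul_of_nonneg_left (sub_le_sub_right hst M) k.cast_nonneg)

theorem cutoff_nonneg (M : ℝ) (k : ℕ) (s : ℝ) : 0 ≤ cutoff M k s :=
  Real.smoothTransition.nonneg _

theorem cutoff_le_one (M : ℝ) (k : ℕ) (s : ℝ) : cutoff M k s ≤ 1 :=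
  Real.smoothTransition.le_one _

theorem cutoff_of_le {s : ℝ} (hs : s ≤ M) : cutoff M k s = 0 :=
  Real.smoothTransition.zero_of_nonpos
    (mul_nonpos_of_nonneg_of_nonpos k.cast_nonneg (sub_nonpos.2 hs))

theorem sub_mul_cutoff_nonneg (M : ℝ) (k : ℕ) (s : ℝ) : 0 ≤ (s - M) * cutoff M k s := by
  rcases le_total s M with hs | hs
  · rw [cutoff_of_le hs, mul_zero]
  · exact mul_nonneg (sub_nonneg.2 hs) (cutoff_nonneg M k s)

theorem monotone_sub_mul_cutoff (M s : ℝ) : Monotone fun k ↦ (s - M) * cutoff M k s := by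
  intro j k hjk
  rcases le_total s M with hs | hs
  · simp only [cutoff_of_le hs, le_refl]
  · have hs' := sub_nonneg.2 hs
    exact mul_le_mul_of_nonneg_left (Real.smoothTransition.monotone
      (mul_le_mul_of_nonneg_right (Nat.cast_le.2 hjk) hs')) hs'

theorem tendsto_ofReal_sub_mul_cutoff (M s : ℝ) :
    Tendsto (fun k ↦ ENNReal.ofReal ((s - M) * cutoff M k s)) atTop
      (𝓝 (ENNReal.ofReal (s - M))) := by
  rcases le_or_gt s M with hs | hs
  · simp only [cutoff_of_le hs, mul_zero, ENNReal.ofReal_zero,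
      ENNReal.ofReal_of_nonpos (sub_nonpos.2 hs), tendsto_const_nhds_iff]
  · have hlarge : ∀ᶠ k : ℕ in atTop, (1 : ℝ) ≤ k * (s - M) :=
      (tendsto_natCast_atTop_atTop.atTop_mul_const (sub_pos.2 hs)).eventually_ge_atTop 1
    refine tendsto_const_nhds.congr' (hlarge.mono fun k hk ↦ ?_)
    simp only [cutoff, Real.smoothTransition.one_of_one_le hk, mul_one]

theorem tendsto_lintegral_ofReal_sub_mul_cutoff (hu : AEMeasurable u μ) (M : ℝ) :
    Tendsto (fun k ↦ ∫⁻ x, ENNReal.ofReal ((u x - M) * cutoff M k (u x)) ∂μ) atTop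
      (𝓝 (∫⁻ x, ENNReal.ofReal (u x - M) ∂μ)) :=
  lintegral_tendsto_of_tendsto_of_monotone
    (fun k ↦ ((hu.sub_const M).mul
      ((contDiff_cutoff M k).continuous.measurable.comp_aemeasurable hu)).ennreal_ofReal)
    (ae_of_all _ fun x _ _ hjk ↦ ENNReal.ofReal_le_ofReal (monotone_sub_mul_cutoff M (u x) hjk))
    (ae_of_all _ fun x ↦ tendsto_ofReal_sub_mul_cutoff M (u x))

theorem memLp_cutoff_comp {p : ℝ≥0∞} (hM : 0 ≤ M) (hu : MemLp u p μ) :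
    MemLp (cutoff M k ∘ u) p μ :=
  (exists_lipschitzWith_cutoff M k).choose_spec.comp_memLp (cutoff_of_le hM) hu

theorem integrable_mul_cutoff_comp (hM : 0 ≤ M) (hf : MemLp f 2 μ) (hu : MemLp u 2 μ) :
    Integrable (fun x ↦ f x * cutoff M k (u x)) μ :=
  hf.integrable_mul (memLp_cutoff_comp hM hu)

theorem integrable_const_mul_cutoff_comp (hM : 0 ≤ M) (hu : MemLp u 2 μ) :
    Integrable (fun x ↦ M * cutoff M k (u x)) μ := by
  refine (integrable_mul_cutoff_comp hM hu hu (k := k)).mono'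
    ((memLp_cutoff_comp hM hu).1.const_mul M) (ae_of_all _ fun x ↦ ?_)
  rw [Real.norm_of_nonneg (mul_nonneg hM (cutoff_nonneg M k _)), ← sub_nonneg, ← sub_mul]
  exact sub_mul_cutoff_nonneg M k (u x)

theorem integrable_sub_mul_cutoff_comp (hM : 0 ≤ M) (hf : MemLp f 2 μ) (hu : MemLp u 2 μ) :
    Integrable (fun x ↦ (f x - M) * cutoff M k (u x)) μ := by
  simp only [sub_mul]
  exact (integrable_mul_cutoff_comp hM hf hu).sub (integrable_const_mul_cutoff_comp hM hu)

theorem integral_sub_mul_cutoff_comp (hM : 0 ≤ M) (hf : MemLp f 2 μ) (hu : MemLp u 2 μ) :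
    ∫ x, (f x - M) * cutoff M k (u x) ∂μ
      = ∫ x, f x * cutoff M k (u x) ∂μ - ∫ x, M * cutoff M k (u x) ∂μ := by
  simp only [sub_mul]
  exact integral_sub (integrable_mul_cutoff_comp hM hf hu)
    (integrable_const_mul_cutoff_comp hM hu)

theorem ofReal_integral_le_lintegral_ofReal (hf : Integrable f μ) :
    ENNReal.ofReal (∫ x, f x ∂μ) ≤ ∫⁻ x, ENNReal.ofReal (f x) ∂μ := by
  rw [integral_eq_lintegral_pos_part_sub_lintegral_neg_part hf]
  exact (ENNReal.ofReal_le_ofReal (sub_le_self _ ENNReal.toReal_nonneg)).trans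
    ENNReal.ofReal_toReal_le

theorem ofReal_integral_sub_mul_cutoff_comp_le (hM : 0 ≤ M) (hf : MemLp f 2 μ)
    (hu : MemLp u 2 μ) : ENNReal.ofReal (∫ x, (f x - M) * cutoff M k (u x) ∂μ)
      ≤ ∫⁻ x, ENNReal.ofReal (f x - M) ∂μ := by
  refine (ofReal_integral_le_lintegral_ofReal (integrable_sub_mul_cutoff_comp hM hf hu)).trans
    (lintegral_mono fun x ↦ ?_)
  rw [ENNReal.ofReal_mul' (cutoff_nonneg M k _)]
  exact mul_le_of_le_one_right' (ENNReal.ofReal_le_one.2 (cutoff_le_one M k _))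

end Truncation

section Comparison

variable {N : ℕ} {D : Set (EuclideanSpace ℝ (Fin N))} {ε δ : ℝ}
  {f g u v : EuclideanSpace ℝ (Fin N) → ℝ}

theorem IsResolventL2.memLp (hD : IsOpen D) (h : IsResolventL2 D ε δ f g u v) :
    MemLp u 2 (bulkMeasure D) ∧ MemLp v 2 (surfaceMeasure D) := by
  obtain ⟨_, _, ⟨_, _, _, _, h, -⟩, -⟩ := h
  obtain ⟨hu, hv, -⟩ := (memVWithGradients_iff hD).1 h
  exact ⟨hu, hv⟩

theorem IsResolventL2.integral_mul_comp_le (hD : IsSmoothOpen D) (hε : 0 ≤ ε) (hδ : 0 < δ)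
    (hf : MemLp f 2 (bulkMeasure D)) (hg : MemLp g 2 (surfaceMeasure D))
    (h : IsResolventL2 D ε δ f g u v) {η : ℝ → ℝ} {C : NNReal} (hη : ContDiff ℝ ∞ η)
    (hηC : LipschitzWith C η) (hη₀ : η 0 = 0) (hmono : Monotone η) :
    ∫ x, u x * η (u x) ∂(bulkMeasure D) + ∫ x, v x * η (v x) ∂(surfaceMeasure D)
      ≤ ∫ x, f x * η (u x) ∂(bulkMeasure D) + ∫ x, g x * η (v x) ∂(surfaceMeasure D) := by
  obtain ⟨p, w, hu, htest⟩ := (isResolventL2_iff hD.isOpen hδ hf hg).1 h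
  have hnonneg {μ : Measure (EuclideanSpace ℝ (Fin N))} {s : EuclideanSpace ℝ (Fin N) → ℝ}
      {P : EuclideanSpace ℝ (Fin N) → EuclideanSpace ℝ (Fin N)} :
      0 ≤ ∫ x, inner ℝ (P x) (((deriv η ∘ s) • P) x) ∂μ := by
    refine integral_nonneg fun x ↦ ?_
    rw [Pi.smul_apply', real_inner_smul_right]
    exact mul_nonneg hmono.deriv_nonneg real_inner_self_nonneg
  have hform := htest _ _ _ _ (hu.comp hD hη hηC hη₀)
  exact (le_add_of_nonneg_right
    (mul_nonneg hδ.le (add_nonneg hnonneg (mul_nonneg hε hnonneg)))).trans_eq hform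

theorem IsResolventL2.lintegral_ofReal_sub_add_le (hD : IsSmoothOpen D) (hε : 0 ≤ ε) (hδ : 0 < δ)
    (hf : MemLp f 2 (bulkMeasure D)) (hg : MemLp g 2 (surfaceMeasure D))
    (h : IsResolventL2 D ε δ f g u v) {M : ℝ} (hM : 0 ≤ M) :
    ∫⁻ x, ENNReal.ofReal (u x - M) ∂(bulkMeasure D)
        + ∫⁻ x, ENNReal.ofReal (v x - M) ∂(surfaceMeasure D)
      ≤ ∫⁻ x, ENNReal.ofReal (f x - M) ∂(bulkMeasure D)
        + ∫⁻ x, ENNReal.ofReal (g x - M) ∂(surfaceMeasure D) := by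
  obtain ⟨hu, hv⟩ := h.memLp hD.isOpen
  refine le_of_tendsto' ((tendsto_lintegral_ofReal_sub_mul_cutoff hu.1.aemeasurable M).add
    (tendsto_lintegral_ofReal_sub_mul_cutoff hv.1.aemeasurable M)) fun k ↦ ?_
  obtain ⟨C, hC⟩ := exists_lipschitzWith_cutoff M k
  have hcutoff : ∫ x, (u x - M) * cutoff M k (u x) ∂(bulkMeasure D)
        + ∫ x, (v x - M) * cutoff M k (v x) ∂(surfaceMeasure D)
      ≤ ∫ x, (f x - M) * cutoff M k (u x) ∂(bulkMeasure D)
        + ∫ x, (g x - M) * cutoff M k (v x) ∂(surfaceMeasure D) := by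
    rw [integral_sub_mul_cutoff_comp hM hu hu, integral_sub_mul_cutoff_comp hM hv hv,
      integral_sub_mul_cutoff_comp hM hf hu, integral_sub_mul_cutoff_comp hM hg hv]
    linarith [h.integral_mul_comp_le hD hε hδ hf hg (contDiff_cutoff M k) hC (cutoff_of_le hM)
      (monotone_cutoff M k)]
  have hnonneg {μ : Measure (EuclideanSpace ℝ (Fin N))} (s : EuclideanSpace ℝ (Fin N) → ℝ) :
      0 ≤ᵐ[μ] fun x ↦ (s x - M) * cutoff M k (s x) :=
    ae_of_all _ fun x ↦ sub_mul_cutoff_nonneg M k (s x)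
  rw [← ofReal_integral_eq_lintegral_ofReal (integrable_sub_mul_cutoff_comp hM hu hu) (hnonneg u),
    ← ofReal_integral_eq_lintegral_ofReal (integrable_sub_mul_cutoff_comp hM hv hv) (hnonneg v),
    ← ENNReal.ofReal_add (integral_nonneg_of_ae (hnonneg u)) (integral_nonneg_of_ae (hnonneg v))]
  exact ((ENNReal.ofReal_le_ofReal hcutoff).trans ENNReal.ofReal_add_le).trans
    (add_le_add (ofReal_integral_sub_mul_cutoff_comp_le hM hf hu)
      (ofReal_integral_sub_mul_cutoff_comp_le hM hg hv))

end Comparison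

theorem existsUnique_continuousLinearMap_of_graph {E F : Type*} [NormedAddCommGroup E]
    [NormedSpace ℝ E] [NormedAddCommGroup F] [NormedSpace ℝ F] [CompleteSpace F]
    (G : Submodule ℝ (E × F)) (hG : Dense (Prod.fst '' (G : Set (E × F)))) {C : ℝ}
    (hC : ∀ z ∈ G, ‖z.2‖ ≤ C * ‖z.1‖) : ∃! T : E →L[ℝ] F, ∀ z ∈ G, T z.1 = z.2 := by
  let e : G →ₗ[ℝ] E := LinearMap.fst ℝ E F ∘ₗ G.subtype
  let f : G →ₗ[ℝ] F := LinearMap.snd ℝ E F ∘ₗ G.subtype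
  have he : DenseRange e := by
    rwa [DenseRange, LinearMap.coe_comp, range_comp, Submodule.coe_subtype, Subtype.range_coe]
  have hf (z : G) : ‖f z‖ ≤ C * ‖e z‖ := hC z z.2
  exact ⟨f.extendOfNorm e, fun z hz ↦ LinearMap.extendOfNorm_eq he ⟨C, hf⟩ ⟨z, hz⟩,
    fun T hT ↦ (LinearMap.extendOfNorm_unique he C hf T (LinearMap.ext fun z ↦ hT z z.2)).symm⟩

theorem dense_setOf_memLp {α E : Type*} [MeasurableSpace α] {μ : Measure α}
    [NormedAddCommGroup E] {p q : ℝ≥0∞} [Fact (1 ≤ p)] (hp : p ≠ ⊤) (hq₀ : q ≠ 0) (hq : q ≠ ⊤) :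
    Dense {f : Lp E p μ | MemLp f q μ} := by
  have hp₀ : p ≠ 0 := (zero_lt_one.trans_le Fact.out).ne'
  refine (Lp.simpleFunc.dense (E := E) (μ := μ) hp).mono fun f hf ↦ ?_
  have hmem : MemLp (Lp.simpleFunc.toSimpleFunc ⟨f, hf⟩) q μ :=
    (SimpleFunc.memLp_iff hq₀ hq).2
      ((SimpleFunc.memLp_iff hp₀ hp).1 (Lp.simpleFunc.memLp ⟨f, hf⟩))
  exact hmem.ae_eq (Lp.simpleFunc.toSimpleFunc_eq_toFun ⟨f, hf⟩)

theorem eLpNorm_one_eq_lintegral_ofReal_add {α : Type*} [MeasurableSpace α] {μ : Measure α}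
    {f : α → ℝ} (hf : AEMeasurable f μ) :
    eLpNorm f 1 μ = ∫⁻ x, ENNReal.ofReal (f x) ∂μ + ∫⁻ x, ENNReal.ofReal (-f x) ∂μ := by
  rw [eLpNorm_one_eq_lintegral_enorm, ← lintegral_add_left' hf.ennreal_ofReal]
  refine lintegral_congr fun x ↦ ?_
  rcases le_total 0 (f x) with hx | hx
  · rw [Real.enorm_of_nonneg hx, ENNReal.ofReal_of_nonpos (neg_nonpos.2 hx), add_zero]
  · rw [ENNReal.ofReal_of_nonpos hx, zero_add, ← Real.enorm_of_nonneg (neg_nonneg.2 hx), enorm_neg]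

section ResolventL1

variable {N : ℕ} {D : Set (EuclideanSpace ℝ (Fin N))} {ε δ : ℝ} {F U : L1Space D} {X : L2Space D}
  {R : L1Space D →L[ℝ] L1Space D}

theorem eLpNorm_one_resolventL2_add_le (hD : IsSmoothOpen D) (hε : 0 ≤ ε) (hδ : 0 < δ)
    (X : L2Space D) :
    eLpNorm (resolventL2 hD ε δ X).fst 1 (bulkMeasure D)
        + eLpNorm (resolventL2 hD ε δ X).snd 1 (surfaceMeasure D)
      ≤ eLpNorm X.fst 1 (bulkMeasure D) + eLpNorm X.snd 1 (surfaceMeasure D) := by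
  have hpos (Y : L2Space D) := (isResolventL2_resolventL2 hD hε hδ Y).lintegral_ofReal_sub_add_le
    hD hε hδ (Lp.memLp _) (Lp.memLp _) le_rfl
  simp only [sub_zero] at hpos
  have hneg := hpos (-X)
  have hcongr {α : Type} [MeasurableSpace α] {μ : Measure α} (f : Lp ℝ 2 μ) :
      ∫⁻ x, ENNReal.ofReal ((-f : Lp ℝ 2 μ) x) ∂μ = ∫⁻ x, ENNReal.ofReal (-f x) ∂μ :=
    lintegral_congr_ae ((Lp.coeFn_neg f).mono fun x hx ↦ congrArg ENNReal.ofReal hx)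
  rw [map_neg, WithLp.neg_fst, WithLp.neg_snd, WithLp.neg_fst, WithLp.neg_snd, hcongr, hcongr,
    hcongr, hcongr] at hneg
  simp only [eLpNorm_one_eq_lintegral_ofReal_add (Lp.aestronglyMeasurable _).aemeasurable]
  rw [add_add_add_comm, add_add_add_comm (∫⁻ x, ENNReal.ofReal (X.fst x) ∂(bulkMeasure D))]
  exact add_le_add (hpos X) hneg

/-- The pairs consisting of an element of `L¹(D) × L¹(Γ)` and the same element of
`L²(D) × L²(Γ)`. -/
def l2Graph (D : Set (EuclideanSpace ℝ (Fin N))) : Submodule ℝ (L1Space D × L2Space D) where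
  carrier := {Z | Z.1.1.1 = Z.2.fst.1 ∧ Z.1.2.1 = Z.2.snd.1}
  add_mem' h h' := ⟨congrArg₂ (· + ·) h.1 h'.1, congrArg₂ (· + ·) h.2 h'.2⟩
  zero_mem' := ⟨rfl, rfl⟩
  smul_mem' c _ h := ⟨congrArg (c • ·) h.1, congrArg (c • ·) h.2⟩

theorem mem_l2Graph_iff : (F, X) ∈ l2Graph D ↔
    F.1 =ᵐ[bulkMeasure D] X.fst ∧ F.2 =ᵐ[surfaceMeasure D] X.snd :=
  and_congr AEEqFun.ext_iff AEEqFun.ext_iff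

/-- The graph of the resolvent, restricted to data and solutions in both `L¹` and `L²`, as a
subspace of the square of `L¹(D) × L¹(Γ)`. -/
def resolventGraph (hD : IsSmoothOpen D) (ε δ : ℝ) : Submodule ℝ (L1Space D × L1Space D) :=
  ((l2Graph D).comap ((LinearMap.fst ℝ _ _).prodMap LinearMap.id) ⊓
    (l2Graph D).comap ((LinearMap.snd ℝ _ _).prodMap (resolventL2 hD ε δ).toLinearMap)).map
      (LinearMap.fst ℝ _ _)

theorem mem_resolventGraph_iff (hD : IsSmoothOpen D) : (F, U) ∈ resolventGraph hD ε δ ↔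
    ∃ X, (F, X) ∈ l2Graph D ∧ (U, resolventL2 hD ε δ X) ∈ l2Graph D := by
  simp [resolventGraph]

theorem norm_le_of_mem_resolventGraph (hD : IsSmoothOpen D) (hε : 0 ≤ ε) (hδ : 0 < δ)
    (h : (F, U) ∈ resolventGraph hD ε δ) : ‖U‖ ≤ 2 * ‖F‖ := by
  obtain ⟨X, hF, hU⟩ := (mem_resolventGraph_iff hD).1 h
  rw [mem_l2Graph_iff] at hF hU
  have hsum := eLpNorm_one_resolventL2_add_le hD hε hδ X
  rw [← eLpNorm_congr_ae hF.1, ← eLpNorm_congr_ae hF.2, ← eLpNorm_congr_ae hU.1,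
    ← eLpNorm_congr_ae hU.2, ← Lp.enorm_def, ← Lp.enorm_def, ← Lp.enorm_def, ← Lp.enorm_def] at hsum
  have hsum' : ‖U.1‖ + ‖U.2‖ ≤ ‖F.1‖ + ‖F.2‖ := by
    simpa only [enorm_eq_nnnorm, ← ENNReal.coe_add, ENNReal.coe_le_coe, ← NNReal.coe_le_coe,
      NNReal.coe_add, coe_nnnorm] using hsum
  calc ‖U‖ ≤ ‖U.1‖ + ‖U.2‖ := max_le_add_of_nonneg (norm_nonneg _) (norm_nonneg _)
    _ ≤ ‖F.1‖ + ‖F.2‖ := hsum'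
    _ ≤ ‖F‖ + ‖F‖ := add_le_add (norm_fst_le F) (norm_snd_le F)
    _ = 2 * ‖F‖ := (two_mul _).symm

theorem exists_mem_resolventGraph (hD : IsSmoothOpen D) (hε : 0 ≤ ε) (hδ : 0 < δ)
    (h : (F, X) ∈ l2Graph D) :
    ∃ U, (F, U) ∈ resolventGraph hD ε δ ∧ (U, resolventL2 hD ε δ X) ∈ l2Graph D := by
  have hF := mem_l2Graph_iff.1 h
  have hfin : eLpNorm X.fst 1 (bulkMeasure D) + eLpNorm X.snd 1 (surfaceMeasure D) < ⊤ := by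
    rw [← eLpNorm_congr_ae hF.1, ← eLpNorm_congr_ae hF.2]
    exact ENNReal.add_lt_top.2 ⟨Lp.eLpNorm_lt_top _, Lp.eLpNorm_lt_top _⟩
  obtain ⟨hu, hv⟩ :=
    ENNReal.add_lt_top.1 ((eLpNorm_one_resolventL2_add_le hD hε hδ X).trans_lt hfin)
  have hu' : MemLp (resolventL2 hD ε δ X).fst 1 (bulkMeasure D) := ⟨Lp.aestronglyMeasurable _, hu⟩
  have hv' : MemLp (resolventL2 hD ε δ X).snd 1 (surfaceMeasure D) :=
    ⟨Lp.aestronglyMeasurable _, hv⟩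
  have hU : ((hu'.toLp, hv'.toLp), resolventL2 hD ε δ X) ∈ l2Graph D :=
    mem_l2Graph_iff.2 ⟨hu'.coeFn_toLp, hv'.coeFn_toLp⟩
  exact ⟨_, (mem_resolventGraph_iff hD).2 ⟨X, h, hU⟩, hU⟩

theorem exists_mem_l2Graph (hf : MemLp F.1 2 (bulkMeasure D))
    (hg : MemLp F.2 2 (surfaceMeasure D)) : ∃ X, (F, X) ∈ l2Graph D :=
  ⟨.toLp 2 (hf.toLp, hg.toLp), mem_l2Graph_iff.2 ⟨hf.coeFn_toLp.symm, hg.coeFn_toLp.symm⟩⟩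

theorem dense_setOf_memLp_two (D : Set (EuclideanSpace ℝ (Fin N))) :
    Dense {F : L1Space D | MemLp F.1 2 (bulkMeasure D) ∧ MemLp F.2 2 (surfaceMeasure D)} :=
  (dense_setOf_memLp ENNReal.one_ne_top two_ne_zero ENNReal.ofNat_ne_top).prod
    (dense_setOf_memLp ENNReal.one_ne_top two_ne_zero ENNReal.ofNat_ne_top)

theorem dense_fst_image_resolventGraph (hD : IsSmoothOpen D) (hε : 0 ≤ ε) (hδ : 0 < δ) :
    Dense (Prod.fst '' (resolventGraph hD ε δ : Set (L1Space D × L1Space D))) := by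
  refine (dense_setOf_memLp_two D).mono fun F hF ↦ ?_
  obtain ⟨X, hX⟩ := exists_mem_l2Graph hF.1 hF.2
  obtain ⟨U, hU, -⟩ := exists_mem_resolventGraph hD hε hδ hX
  exact ⟨(F, U), hU, rfl⟩

theorem isResolventL1_iff (hD : IsSmoothOpen D) (hε : 0 ≤ ε) (hδ : 0 < δ) :
    IsResolventL1 D ε δ R ↔ ∀ Z ∈ resolventGraph hD ε δ, R Z.1 = Z.2 := by
  constructor
  · rintro hR ⟨F, U⟩ hZ
    obtain ⟨X, hF, hU⟩ := (mem_resolventGraph_iff hD).1 hZ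
    rw [mem_l2Graph_iff] at hF hU
    have hRF := hR F ((Lp.memLp X.fst).ae_eq hF.1.symm) ((Lp.memLp X.snd).ae_eq hF.2.symm)
    obtain ⟨hu, hv⟩ :=
      (hRF.congr_ae hD.isOpen hF.1 hF.2 .rfl .rfl).ae_eq_resolventL2 hD hε hδ
    exact Prod.ext (Lp.ext (hu.trans hU.1.symm)) (Lp.ext (hv.trans hU.2.symm))
  · intro hR F hf hg
    obtain ⟨X, hX⟩ := exists_mem_l2Graph hf hg
    obtain ⟨U, hFU, hU⟩ := exists_mem_resolventGraph hD hε hδ hX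
    rw [hR (F, U) hFU]
    rw [mem_l2Graph_iff] at hX hU
    exact (isResolventL2_resolventL2 hD hε hδ X).congr_ae hD.isOpen hX.1.symm hX.2.symm hU.1.symm
      hU.2.symm

theorem existsUnique_isResolventL1 (hD : IsSmoothOpen D) (hε : 0 ≤ ε) (hδ : 0 < δ) :
    ∃! R, IsResolventL1 D ε δ R := by
  simp only [isResolventL1_iff hD hε hδ]
  exact existsUnique_continuousLinearMap_of_graph _ (dense_fst_image_resolventGraph hD hε hδ)
    fun Z hZ ↦ norm_le_of_mem_resolventGraph hD hε hδ hZ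

theorem continuous_lintegral_ofReal_sub {α : Type*} [MeasurableSpace α] {μ : Measure α} {M : ℝ}
    (hM : 0 ≤ M) : Continuous fun f : Lp ℝ 1 μ ↦ ∫⁻ x, ENNReal.ofReal (f x - M) ∂μ := by
  have hlip : LipschitzWith (1 + 0) fun s : ℝ ↦ max (s - M) 0 :=
    (LipschitzWith.id.sub (LipschitzWith.const M)).max_const 0
  have hzero : max (0 - M) 0 = 0 := max_eq_right (by rwa [zero_sub, neg_nonpos])
  refine (hlip.continuous_compLp hzero).enorm.congr fun f ↦ ?_
  rw [Lp.enorm_def, eLpNorm_congr_ae (hlip.coeFn_compLp hzero f), eLpNorm_one_eq_lintegral_enorm]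
  refine lintegral_congr fun x ↦ ?_
  rw [Function.comp_apply, Real.enorm_of_nonneg (le_max_right _ _), ENNReal.ofReal_max,
    ENNReal.ofReal_zero, max_eq_left zero_le]

theorem IsResolventL1.lintegral_ofReal_sub_add_le (hD : IsSmoothOpen D) (hε : 0 ≤ ε) (hδ : 0 < δ)
    (hR : IsResolventL1 D ε δ R) {M : ℝ} (hM : 0 ≤ M) (F : L1Space D) :
    ∫⁻ x, ENNReal.ofReal ((R F).1 x - M) ∂(bulkMeasure D)
        + ∫⁻ x, ENNReal.ofReal ((R F).2 x - M) ∂(surfaceMeasure D)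
      ≤ ∫⁻ x, ENNReal.ofReal (F.1 x - M) ∂(bulkMeasure D)
        + ∫⁻ x, ENNReal.ofReal (F.2 x - M) ∂(surfaceMeasure D) := by
  have hbulk := continuous_lintegral_ofReal_sub (μ := bulkMeasure D) hM
  have hsurf := continuous_lintegral_ofReal_sub (μ := surfaceMeasure D) hM
  refine (dense_setOf_memLp_two D).induction
    (fun F hF ↦ (hR F hF.1 hF.2).lintegral_ofReal_sub_add_le hD hε hδ hF.1 hF.2 hM)
    (isClosed_le ?_ ?_) F
  · exact (hbulk.comp (continuous_fst.comp R.continuous)).add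
      (hsurf.comp (continuous_snd.comp R.continuous))
  · exact (hbulk.comp continuous_fst).add (hsurf.comp continuous_snd)

theorem lintegral_ofReal_sub_eq_zero_iff {α : Type*} [MeasurableSpace α] {μ : Measure α}
    {f : α → ℝ} (hf : AEMeasurable f μ) {M : ℝ} :
    ∫⁻ x, ENNReal.ofReal (f x - M) ∂μ = 0 ↔ ∀ᵐ x ∂μ, f x ≤ M := by
  rw [lintegral_eq_zero_iff' (hf.sub_const M).ennreal_ofReal]
  exact eventually_congr (ae_of_all _ fun x ↦ ENNReal.ofReal_eq_zero.trans sub_nonpos)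

theorem IsResolventL1.ae_le (hD : IsSmoothOpen D) (hε : 0 ≤ ε) (hδ : 0 < δ)
    (hR : IsResolventL1 D ε δ R) {M : ℝ} (hM : 0 ≤ M)
    (hf : ∀ᵐ x ∂(bulkMeasure D), F.1 x ≤ M) (hg : ∀ᵐ x ∂(surfaceMeasure D), F.2 x ≤ M) :
    (∀ᵐ x ∂(bulkMeasure D), (R F).1 x ≤ M) ∧ ∀ᵐ x ∂(surfaceMeasure D), (R F).2 x ≤ M := by
  have hmeas {α : Type} [MeasurableSpace α] {μ : Measure α} (f : Lp ℝ 1 μ) : AEMeasurable f μ :=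
    (Lp.aestronglyMeasurable f).aemeasurable
  have hle := hR.lintegral_ofReal_sub_add_le hD hε hδ hM F
  rwa [(lintegral_ofReal_sub_eq_zero_iff (hmeas _)).2 hf,
    (lintegral_ofReal_sub_eq_zero_iff (hmeas _)).2 hg, add_zero, nonpos_iff_eq_zero, add_eq_zero,
    lintegral_ofReal_sub_eq_zero_iff (hmeas _), lintegral_ofReal_sub_eq_zero_iff (hmeas _)] at hle

end ResolventL1

theorem mainTheorem4_general {N : ℕ} {D : Set (EuclideanSpace ℝ (Fin N))} (hD : IsSmoothOpen D)
    {ε δ : ℝ} (hε : 0 ≤ ε) (hδ : 0 < δ) :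
    (∃! R : L1Space D →L[ℝ] L1Space D, IsResolventL1 D ε δ R) ∧
    ∀ R : L1Space D →L[ℝ] L1Space D, IsResolventL1 D ε δ R → ∀ c₁ c₂ : ℝ, 0 ≤ max c₁ c₂ →
      ∀ (f : Lp ℝ 1 (bulkMeasure D)) (g : Lp ℝ 1 (surfaceMeasure D)),
        (∀ᵐ x ∂(bulkMeasure D), f x ≤ c₁) → (∀ᵐ x ∂(surfaceMeasure D), g x ≤ c₂) →
        (∀ᵐ x ∂(bulkMeasure D), (R (f, g)).1 x ≤ max c₁ c₂) ∧
        (∀ᵐ x ∂(surfaceMeasure D), (R (f, g)).2 x ≤ max c₁ c₂) :=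
  ⟨existsUnique_isResolventL1 hD hε hδ, fun _ hR _ _ hc _ _ hf hg ↦ hR.ae_le hD hε hδ hc
    (hf.mono fun _ hx ↦ le_max_of_le_left hx) (hg.mono fun _ hx ↦ le_max_of_le_right hx)⟩

end WentzellResolvent

end

theorem mainTheorem4 (N : ℕ) (hN : 2 ≤ N) (D : Set (EuclideanSpace ℝ (Fin N)))
    (hD : WentzellResolvent.IsSmoothBoundedDomain D) (ε δ : ℝ) (hε : 0 ≤ ε) (hδ : 0 < δ) :
    (∃! R : WentzellResolvent.L1Space D →L[ℝ] WentzellResolvent.L1Space D,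
      WentzellResolvent.IsResolventL1 D ε δ R) ∧
    ∀ R : WentzellResolvent.L1Space D →L[ℝ] WentzellResolvent.L1Space D,
      WentzellResolvent.IsResolventL1 D ε δ R →
      ∀ c₁ c₂ : ℝ, 0 < c₁ → 0 < c₂ →
      ∀ (f : Lp ℝ 1 (WentzellResolvent.bulkMeasure D))
        (g : Lp ℝ 1 (WentzellResolvent.surfaceMeasure D)),
        (∀ᵐ x ∂(WentzellResolvent.bulkMeasure D), f x ≤ c₁) →
        (∀ᵐ x ∂(WentzellResolvent.surfaceMeasure D), g x ≤ c₂) →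
        (∀ᵐ x ∂(WentzellResolvent.bulkMeasure D), (R (f, g)).1 x ≤ max c₁ c₂) ∧
        (∀ᵐ x ∂(WentzellResolvent.surfaceMeasure D), (R (f, g)).2 x ≤ max c₁ c₂) := by
  obtain ⟨hex, hmax⟩ := WentzellResolvent.mainTheorem4_general hD.isSmoothOpen hε hδ
  exact ⟨hex, fun R hR c₁ c₂ hc₁ _ ↦ hmax R hR c₁ c₂ (le_max_of_le_left hc₁.le)⟩
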